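/- **Lemma (covering $B_p$ by $\widehat{B_2}$, $0<p<2$).** All $\log$s are base $2$. Let $\mathbf A\in\mathbb R^{k\times n}$ have rows $\bm a_1,\dots,\bm a_k$, let $S_1,\dots,S_m$ be a partition of $[k]$ into nonempty groups, let $p_1,\dots,p_m>0$ and $0<p<2$. Put $$B_p=\Big\{x\in\mathbb R^n:\Big(\sum_{i=1}^m\|\mathbf A_{S_i}x\|_{p_i}^p\Big)^{1/p}\le 1\Big\},\qquad \|y_{S_i}\|_{p_i}=\Big(\sum_{j\in S_i}|y_j|^{p_i}\Big)^{1/p_i}.$$ Let $\lambda$ be a probability measure on $[m]$ with all $\lambda_i>0$, let $\mathbf\Lambda\in\mathbb R^{k\times k}$ be the diagonal matrix with $\mathbf\Lambda_{jj}=\lambda_i$ for $j\in S_i$, and let $\mathbf W$ be a diagonal matrix with diagonal entries $w_j>0$ that rounds $\mathbf\Lambda$, i.e. for all $x\in\mathbb R^n$ $$\|\mathbf W^{1/2}\mathbf\Lambda^{1/2-1/p}\mathbf Ax\|_2\le\Big(\sum_{i=1}^m\|(\mathbf\Lambda^{1/2-1/p}\mathbf Ax)_{S_i}\|_{p_i}^2\Big)^{1/2}.$$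 Put $\widehat{B_2}=\{x:\|\mathbf W^{1/2}\mathbf\Lambda^{1/2-1/p}\mathbf Ax\|_2\le1\}$. Suppose that $\lambda$ and $\mathbf W$ form an $F^\star$-block Lewis overestimate with $F^\star>0$, i.e. for all $i$ $$\frac1{\lambda_i}\Big(\sum_{j\in S_i}\Big(\frac{\tau_j(\mathbf W^{1/2}\mathbf\Lambda^{1/2-1/p}\mathbf A)}{w_j}\Big)^{p_i/2}\Big)^{2/p_i}\le F^\star,$$ where $\tau_j(\mathbf M)=\bm m_j^\top(\mathbf M^\top\mathbf M)^{+}\bm m_j$ is the leverage score of the $j$th row $\bm m_j$ of $\mathbf M$ (with the pseudoinverse). Let $q_0>0$ be such that $p_i\ge q_0$ for every $i$ with $|S_i|\ge2$. Let $\mathcal N(X,Y)$ denote the least number of translates of $Y$ that cover $X$. Then for every $\eta>0$ the number $\mathcal N(B_p,\eta\widehat{B_2})$ is finite and $$\log\mathcal N(B_p,\eta\widehat{B_2})\le\eta^{-\frac{2p}{2-p}}\cdot C\cdot\max\Big\{1,\max_i\min(p_i,\log|S_i|)\Big\}\cdot F^\star\log\max\{2,F^\star\},$$ where $C>0$ depends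 only on $p$ and $q_0$. In particular (taking $q_0=\min(1,p)$) the constant depends only on $p$ if every group $S_i$ with at least two elements has $p_i\ge\min(1,p)$. -/

import Mathlib

open scoped Matrix Pointwise

namespace BlockLewis

noncomputable section

/-- The pseudoinverse of a real symmetric matrix: the sum of `μ⁻¹ u uᵀ` over an orthonormal basis
of eigenvectors `u` with eigenvalue `μ`. Zero eigenvalues contribute nothing, as `0⁻¹ = 0`. -/
def symmPinv {ι : Type*} [Fintype ι] [DecidableEq ι] (M : Matrix ι ι ℝ) (hM : M.IsHermitian) :
    Matrix ι ι ℝ :=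
  ∑ i, (hM.eigenvalues i)⁻¹ •
    Matrix.vecMulVec (⇑(hM.eigenvectorBasis i)) (⇑(hM.eigenvectorBasis i))

/-- The Gram matrix `Mᵀ M` is symmetric. -/
theorem gram_isHermitian {k n : ℕ} (M : Matrix (Fin k) (Fin n) ℝ) : (Mᵀ * M).IsHermitian := by
  rw [← Matrix.conjTranspose_eq_transpose_of_trivial]
  exact Matrix.isHermitian_conjTranspose_mul_self M

/-- The leverage score `τ_j(M) = m_jᵀ (Mᵀ M)⁻¹ m_j` of the row `m_j` of `M`,
with the inverse read as a pseudoinverse. -/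
def leverageScore {k n : ℕ} (M : Matrix (Fin k) (Fin n) ℝ) (j : Fin k) : ℝ :=
  M j ⬝ᵥ (symmPinv (Mᵀ * M) (gram_isHermitian M) *ᵥ M j)

/-- The group `S_i` of the partition of the rows that is given by the map `blk` sending a row to
(the index of) its group. -/
def group {k m : ℕ} (blk : Fin k → Fin m) (i : Fin m) : Finset (Fin k) :=
  {j | blk j = i}

/-- The inner quantity `‖y_{S_i}‖_{p_i} = (∑_{j ∈ S_i} |y_j|^{p_i})^{1/p_i}`. -/
def groupNorm {k m : ℕ} (blk : Fin k → Fin m) (q : Fin m → ℝ) (y : Fin k → ℝ) (i : Fin m) : ℝ :=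
  (∑ j ∈ group blk i, |y j| ^ q i) ^ (1 / q i)

/-- The block norm with outer exponent `r` and inner exponents `q i`:
`(∑_i ‖y_{S_i}‖_{q i}^r)^{1/r}`. -/
def blockNorm {k m : ℕ} (blk : Fin k → Fin m) (q : Fin m → ℝ) (r : ℝ) (y : Fin k → ℝ) : ℝ :=
  (∑ i, groupNorm blk q y i ^ r) ^ (1 / r)

/-- The matrix `Λ^s A`, where `Λ` is the diagonal matrix, constant down the groups, whose
diagonal entries on `S_i` are `lam i`. -/
def measureScaled {k n m : ℕ} (blk : Fin k → Fin m) (lam : Fin m → ℝ) (s : ℝ)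
    (A : Matrix (Fin k) (Fin n) ℝ) : Matrix (Fin k) (Fin n) ℝ :=
  Matrix.diagonal (fun j => lam (blk j) ^ s) * A

/-- The matrix `W^{1/2} Λ^{1/2 - 1/p} A`, where `W` is diagonal with diagonal `w`. -/
def roundedMatrix {k n m : ℕ} (blk : Fin k → Fin m) (p : ℝ) (lam : Fin m → ℝ) (w : Fin k → ℝ)
    (A : Matrix (Fin k) (Fin n) ℝ) : Matrix (Fin k) (Fin n) ℝ :=
  Matrix.diagonal (fun j => w j ^ (1 / 2 : ℝ)) * measureScaled blk lam (1 / 2 - 1 / p) A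

/-- The Euclidean norm of `y ∈ ℝ^k`. -/
def l2Norm {k : ℕ} (y : Fin k → ℝ) : ℝ :=
  ‖(WithLp.toLp 2 y : EuclideanSpace ℝ (Fin k))‖

/-- A probability measure on the index set of the groups, charging every group. -/
structure IsPosProb {m : ℕ} (lam : Fin m → ℝ) : Prop where
  pos : ∀ i, 0 < lam i
  sum_eq_one : ∑ i, lam i = 1

/-- The positive diagonal matrix with diagonal `w` rounds the measure `lam`. -/
structure IsRounding {k n m : ℕ} (A : Matrix (Fin k) (Fin n) ℝ) (blk : Fin k → Fin m)
    (q : Fin m → ℝ) (p : ℝ) (lam : Fin m → ℝ) (w : Fin k → ℝ) : Prop where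
  pos : ∀ j, 0 < w j
  le : ∀ x : Fin n → ℝ, l2Norm (roundedMatrix blk p lam w A *ᵥ x) ≤
    blockNorm blk q 2 (measureScaled blk lam (1 / 2 - 1 / p) A *ᵥ x)

/-- The probability measure `lam` and the rounding `w` form an `F`-block Lewis overestimate. -/
structure IsBlockLewisOverestimate {k n m : ℕ} (A : Matrix (Fin k) (Fin n) ℝ)
    (blk : Fin k → Fin m) (q : Fin m → ℝ) (p : ℝ) (lam : Fin m → ℝ) (w : Fin k → ℝ) (F : ℝ) :
    Prop where
  F_pos : 0 < F
  prob : IsPosProb lam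
  rounding : IsRounding A blk q p lam w
  le : ∀ i, 1 / lam i *
    (∑ j ∈ group blk i,
      (leverageScore (roundedMatrix blk p lam w A) j / w j) ^ (q i / 2)) ^ (2 / q i) ≤ F

/-- The unit ball `B_p` of `x ↦ (∑_i ‖A_{S_i} x‖_{p_i}^p)^{1/p}`. -/
def blockBall {k n m : ℕ} (A : Matrix (Fin k) (Fin n) ℝ) (blk : Fin k → Fin m)
    (q : Fin m → ℝ) (p : ℝ) : Set (Fin n → ℝ) :=
  {x | blockNorm blk q p (A *ᵥ x) ≤ 1}

/-- The set of `x` with `‖W^{1/2} Λ^{1/2 - 1/p} A x‖₂ ≤ 1`. -/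
def roundedBall {k n m : ℕ} (A : Matrix (Fin k) (Fin n) ℝ) (blk : Fin k → Fin m)
    (p : ℝ) (lam : Fin m → ℝ) (w : Fin k → ℝ) : Set (Fin n → ℝ) :=
  {x | l2Norm (roundedMatrix blk p lam w A *ᵥ x) ≤ 1}

/-- The covering number of `X` by `Y`: the least number of translates of `Y` that cover `X`
(`⊤` if no finite number suffices). -/
def coveringNumber {n : ℕ} (X Y : Set (Fin n → ℝ)) : ℕ∞ :=
  ⨅ (N : ℕ) (_ : ∃ x : Fin N → (Fin n → ℝ), X ⊆ ⋃ i, (x i +ᵥ Y)), (N : ℕ∞)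

/-- The factor `max(1, max_i min(p_i, log₂ |S_i|))`. -/
def innerFactor {k m : ℕ} (blk : Fin k → Fin m) (q : Fin m → ℝ) : ℝ :=
  max 1 (⨆ i, min (q i) (Real.logb 2 ((group blk i).card : ℝ)))

end

end BlockLewis

/-! The map x ↦ W^{1/2} Λ^{1/2-1/p} A x to the column space E of the rounded matrix turns
`roundedBall` into the Euclidean unit ball. With f_i(y) = λ_i^{-1/2} ‖(W^{-1/2} y)_{S_i}‖_{p_i} and
G_r(y) = ∑ λ_i f_i(y)^r, it turns `blockBall` into {G_p ≤ 1}, because λ_i f_i^p is the p-th power of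
the original group norm. Rounding says ‖y‖² ≤ G_2(y). The overestimate condition says f_i(y) ≤ √F
‖y‖, since τ_j bounds the squared norm of the projection of e_j to E. Nothing else about the matrix
is needed (`IsGaugeFamily`).

By Hölder, G_2 is bounded by a product of powers of G_p and G_s for s > 2
(`norm_sq_le_interpolation`). Hence points of {G_p ≤ 1} that are η-apart in Euclidean norm are
δ-apart in G_s^{1/s} for an explicit δ. A dual Sudakov argument bounds the number of such points in
a ball of radius 2η by exp(O(F s (η/δ)²)): a sublevel set of G_s of at least half the Gaussian mass
has disjoint dilated shifts, and a shift of a symmetric set by z costs at most the factor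
exp(-‖z‖²/2) (`card_le_of_gaugeSum_separated`). The Gaussian moment of G_s is at most (4√(Fs))^s
once s ≥ min(p_i, log|S_i|) and s ≥ 1, because an ℓ_q norm on N ≥ 2 coordinates with q ≥ log N is
within a factor 2 of the ℓ_{log N} norm.

For s a multiple of `innerFactor` times log max(2, F), the one-scale bound is exp(O(F s
η^{-2p/(2-p)})). Refining covers from radius 2η to η sums these bounds geometrically, starting from
the radius F^{(2-p)/(2p)}, where one ball suffices (`exists_cover`). -/

namespace BlockLewis

open MeasureTheory

/-! ### Gaussian measure: shifts, moments and packing -/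

section Gaussian

variable {V : Type*} [NormedAddCommGroup V] [InnerProductSpace ℝ V] [FiniteDimensional ℝ V]
  [MeasurableSpace V] [BorelSpace V]

set_option linter.unusedSectionVars false

/-- The unnormalized standard Gaussian density `exp (-‖v‖² / 2)`. -/
noncomputable def gaussianWeight (v : V) : ENNReal := ENNReal.ofReal (Real.exp (-‖v‖ ^ 2 / 2))

theorem measurable_gaussianWeight : Measurable (gaussianWeight : V → ENNReal) := by
  unfold gaussianWeight
  fun_prop

variable (V) in
/-- The unnormalized standard Gaussian measure on a Euclidean space. -/
noncomputable def gaussianVolume : Measure V := volume.withDensity gaussianWeight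

theorem gaussianVolume_univ_ne_top : gaussianVolume V Set.univ ≠ ⊤ := by
  have h : Integrable (fun v : V => Real.exp (-‖v‖ ^ 2 / 2)) := by
    have := (GaussianFourier.integrable_cexp_neg_mul_sq_norm_add (V := V) (b := (1 / 2 : ℂ))
      (by norm_num) 0 0).norm
    refine this.congr (Filter.Eventually.of_forall fun v => ?_)
    simp only [Complex.norm_exp]
    congr 1
    simp [← Complex.ofReal_pow]
    ring
  rw [gaussianVolume, withDensity_apply _ MeasurableSet.univ, Measure.restrict_univ]
  exact (h.lintegral_lt_top).ne

theorem gaussianVolume_univ_ne_zero : gaussianVolume V Set.univ ≠ 0 := by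
  rw [gaussianVolume, withDensity_apply _ MeasurableSet.univ, Measure.restrict_univ]
  intro h
  rw [lintegral_eq_zero_iff measurable_gaussianWeight] at h
  have h2 : ∀ᵐ v : V, False := by
    filter_upwards [h] with v hv
    have : 0 < gaussianWeight v := by simp [gaussianWeight, Real.exp_pos]
    exact this.ne' hv
  simp at h2
  exact NeZero.ne (volume : Measure V) h2

/-- Completing the square turns the integrand into a translate of the Gaussian weight. -/
theorem lintegral_exp_inner_gaussianVolume (z : V) :
    ∫⁻ v, ENNReal.ofReal (Real.exp (inner ℝ z v)) ∂(gaussianVolume V) =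
      ENNReal.ofReal (Real.exp (‖z‖ ^ 2 / 2)) * gaussianVolume V Set.univ := by
  rw [gaussianVolume, lintegral_withDensity_eq_lintegral_mul _ measurable_gaussianWeight
    (by fun_prop), withDensity_apply _ MeasurableSet.univ, Measure.restrict_univ,
    ← lintegral_sub_right_eq_self (gaussianWeight : V → ENNReal) z,
    ← lintegral_const_mul _ (by exact measurable_gaussianWeight.comp (measurable_sub_const z))]
  refine lintegral_congr fun v => ?_
  simp only [Pi.mul_apply, gaussianWeight]
  rw [← ENNReal.ofReal_mul (Real.exp_pos _).le, ← ENNReal.ofReal_mul (Real.exp_pos _).le,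
    ← Real.exp_add, ← Real.exp_add, norm_sub_sq_real, real_inner_comm]
  congr 2
  ring

/-- Shifting a symmetric set by `z` decreases its Gaussian measure at most by the factor
`exp (-‖z‖² / 2)`. -/
theorem gaussianVolume_shift_le {K : Set V} (hK : MeasurableSet K) (hsymm : ∀ v, -v ∈ K ↔ v ∈ K)
    (z : V) :
    ENNReal.ofReal (Real.exp (-‖z‖ ^ 2 / 2)) * gaussianVolume V K ≤
      gaussianVolume V {v | v - z ∈ K} := by
  have hK' : MeasurableSet {v | v - z ∈ K} := measurable_sub_const z hK
  have hw := measurable_gaussianWeight (V := V)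
  have e1 : gaussianVolume V {v | v - z ∈ K} = ∫⁻ v in K, gaussianWeight (v + z) := by
    rw [gaussianVolume, withDensity_apply _ hK', ← lintegral_indicator hK',
      ← lintegral_indicator hK, ← lintegral_add_right_eq_self _ z]
    refine lintegral_congr fun v => ?_
    by_cases h : v ∈ K
    · rw [Set.indicator_of_mem h, Set.indicator_of_mem (by simpa using h)]
    · rw [Set.indicator_of_notMem h, Set.indicator_of_notMem (by simpa using h)]
  have e2 : gaussianVolume V {v | v - z ∈ K} = ∫⁻ v in K, gaussianWeight (-v + z) := by
    rw [e1, ← lintegral_indicator hK, ← lintegral_indicator hK, ← lintegral_neg_eq_self]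
    refine lintegral_congr fun v => ?_
    by_cases h : v ∈ K
    · rw [Set.indicator_of_mem h, Set.indicator_of_mem ((hsymm v).2 h)]
    · rw [Set.indicator_of_notMem h, Set.indicator_of_notMem (mt (hsymm v).1 h)]
  -- Symmetry gives two formulas for the shifted mass, with weights at v + z and -v + z. Their sum
  -- is exp(-‖z‖²/2) exp(-‖v‖²/2) (e^c + e^{-c}) with c = ⟪v, z⟫, and e^c + e^{-c} ≥ 2.
  have key : 2 * (ENNReal.ofReal (Real.exp (-‖z‖ ^ 2 / 2)) * gaussianVolume V K) ≤
      2 * gaussianVolume V {v | v - z ∈ K} := by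
    calc 2 * (ENNReal.ofReal (Real.exp (-‖z‖ ^ 2 / 2)) * gaussianVolume V K)
        = ∫⁻ v in K, 2 * (ENNReal.ofReal (Real.exp (-‖z‖ ^ 2 / 2)) * gaussianWeight v) := by
          rw [lintegral_const_mul _ (hw.const_mul _), lintegral_const_mul _ hw, gaussianVolume,
            withDensity_apply _ hK]
      _ ≤ ∫⁻ v in K, (gaussianWeight (v + z) + gaussianWeight (-v + z)) := by
          refine lintegral_mono fun v => ?_
          simp only [gaussianWeight]
          rw [← ENNReal.ofReal_mul (Real.exp_pos _).le, ← ENNReal.ofReal_add (Real.exp_pos _).le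
            (Real.exp_pos _).le, ← Real.exp_add, ← ENNReal.ofReal_ofNat 2,
            ← ENNReal.ofReal_mul (by norm_num)]
          apply ENNReal.ofReal_le_ofReal
          rw [norm_add_sq_real, norm_add_sq_real, norm_neg, inner_neg_left]
          set x := ‖v‖ ^ 2
          set y := ‖z‖ ^ 2
          set c := (inner ℝ v z : ℝ)
          have h1 : Real.exp (-(x + 2 * c + y) / 2) = Real.exp (-y / 2 + -x / 2) * Real.exp (-c) := by
            rw [← Real.exp_add]; congr 1; ring
          have h2 : Real.exp (-(x + 2 * -c + y) / 2) = Real.exp (-y / 2 + -x / 2) * Real.exp c := by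
            rw [← Real.exp_add]; congr 1; ring
          rw [h1, h2, ← mul_add, mul_comm]
          refine mul_le_mul_of_nonneg_left ?_ (Real.exp_pos _).le
          linarith [Real.add_one_le_exp c, Real.add_one_le_exp (-c)]
      _ = 2 * gaussianVolume V {v | v - z ∈ K} := by
          rw [lintegral_add_left (by exact hw.comp (measurable_add_const z)), ← e1, ← e2, two_mul]
  exact (ENNReal.mul_le_mul_iff_right (by norm_num) (by norm_num)).1 key

/-- The inequality y ≤ exp(y - 1) at y = |x|/√s, raised to the power s. This scaling makes the
moment bound of order s^{s/2}. -/
theorem abs_rpow_le_exp {s : ℝ} (hs : 0 < s) (x : ℝ) :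
    |x| ^ s ≤ s ^ (s / 2) * Real.exp (-s) *
      (Real.exp (Real.sqrt s * x) + Real.exp (-(Real.sqrt s * x))) := by
  have hs' : 0 < Real.sqrt s := Real.sqrt_pos.2 hs
  have hy : 0 ≤ |x| / Real.sqrt s := by positivity
  have h1 : |x| ^ s = s ^ (s / 2) * (|x| / Real.sqrt s) ^ s := by
    rw [Real.div_rpow (abs_nonneg x) hs'.le, Real.sqrt_eq_rpow, ← Real.rpow_mul hs.le,
      one_div_mul_eq_div]
    field_simp
  have h2 : |x| / Real.sqrt s ≤ Real.exp (|x| / Real.sqrt s - 1) := by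
    linarith [Real.add_one_le_exp (|x| / Real.sqrt s - 1)]
  have h3 : (|x| / Real.sqrt s) ^ s ≤ Real.exp (-s) * Real.exp (Real.sqrt s * |x|) := by
    refine (Real.rpow_le_rpow hy h2 hs.le).trans_eq ?_
    rw [← Real.exp_mul, ← Real.exp_add]
    congr 1
    have h5 : |x| / Real.sqrt s * s = Real.sqrt s * |x| := by
      rw [div_mul_eq_mul_div, div_eq_iff hs'.ne', mul_comm (Real.sqrt s), mul_assoc,
        Real.mul_self_sqrt hs.le]
    rw [sub_mul, h5]
    ring
  have h4 : Real.exp (Real.sqrt s * |x|) ≤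
      Real.exp (Real.sqrt s * x) + Real.exp (-(Real.sqrt s * x)) := by
    rcases abs_cases x with ⟨h, -⟩ | ⟨h, -⟩
    · rw [h]; linarith [Real.exp_pos (-(Real.sqrt s * x))]
    · rw [h, mul_neg]; linarith [Real.exp_pos (Real.sqrt s * x)]
  rw [h1, mul_assoc]
  have := Real.rpow_pos_of_pos hs (s / 2)
  gcongr
  exact h3.trans (by gcongr)

theorem lintegral_abs_inner_rpow_le {s : ℝ} (hs : 0 < s) (u : V) (hu : ‖u‖ ≤ 1) :
    ∫⁻ v, ENNReal.ofReal (|inner ℝ u v| ^ s) ∂(gaussianVolume V) ≤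
      ENNReal.ofReal (2 * s ^ (s / 2)) * gaussianVolume V Set.univ := by
  have hc : 0 ≤ s ^ (s / 2) * Real.exp (-s) := by positivity
  have hnorm : ∀ z : V, ‖z‖ ≤ Real.sqrt s → ENNReal.ofReal (Real.exp (‖z‖ ^ 2 / 2)) ≤
      ENNReal.ofReal (Real.exp (s / 2)) := fun z hz => by
    apply ENNReal.ofReal_le_ofReal
    have : ‖z‖ ^ 2 ≤ s := by
      rw [← Real.sq_sqrt hs.le]; gcongr
    gcongr
  have hz : ‖Real.sqrt s • u‖ ≤ Real.sqrt s := by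
    rw [norm_smul, Real.norm_of_nonneg (Real.sqrt_nonneg s)]
    exact mul_le_of_le_one_right (Real.sqrt_nonneg s) hu
  calc ∫⁻ v, ENNReal.ofReal (|inner ℝ u v| ^ s) ∂(gaussianVolume V)
      ≤ ∫⁻ v, ENNReal.ofReal (s ^ (s / 2) * Real.exp (-s)) *
          (ENNReal.ofReal (Real.exp (inner ℝ (Real.sqrt s • u) v)) +
          ENNReal.ofReal (Real.exp (inner ℝ (-(Real.sqrt s • u)) v))) ∂(gaussianVolume V) := by
        refine lintegral_mono fun v => ?_
        rw [← ENNReal.ofReal_add (Real.exp_pos _).le (Real.exp_pos _).le, ← ENNReal.ofReal_mul hc,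
          inner_neg_left, real_inner_smul_left]
        exact ENNReal.ofReal_le_ofReal (abs_rpow_le_exp hs _)
    _ = ENNReal.ofReal (s ^ (s / 2) * Real.exp (-s)) *
          (ENNReal.ofReal (Real.exp (‖Real.sqrt s • u‖ ^ 2 / 2)) * gaussianVolume V Set.univ +
          ENNReal.ofReal (Real.exp (‖-(Real.sqrt s • u)‖ ^ 2 / 2)) *
            gaussianVolume V Set.univ) := by
        rw [lintegral_const_mul _ (by fun_prop), lintegral_add_left (by fun_prop),
          lintegral_exp_inner_gaussianVolume, lintegral_exp_inner_gaussianVolume]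
    _ ≤ ENNReal.ofReal (s ^ (s / 2) * Real.exp (-s)) *
          (ENNReal.ofReal (Real.exp (s / 2)) * gaussianVolume V Set.univ +
          ENNReal.ofReal (Real.exp (s / 2)) * gaussianVolume V Set.univ) := by
        have h1 := hnorm _ hz
        have h2 := hnorm _ ((norm_neg _).trans_le hz)
        exact mul_le_mul_right (add_le_add (mul_le_mul_left h1 _) (mul_le_mul_left h2 _)) _
    _ = ENNReal.ofReal (s ^ (s / 2) * Real.exp (-s) * (Real.exp (s / 2) + Real.exp (s / 2))) *
          gaussianVolume V Set.univ := by
        rw [← add_mul, ← mul_assoc, ← ENNReal.ofReal_add (Real.exp_pos _).le (Real.exp_pos _).le,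
          ← ENNReal.ofReal_mul hc]
    _ ≤ ENNReal.ofReal (2 * s ^ (s / 2)) * gaussianVolume V Set.univ := by
        refine mul_le_mul_left (ENNReal.ofReal_le_ofReal ?_) _
        have h1 : Real.exp (-s) * Real.exp (s / 2) ≤ 1 := by
          rw [← Real.exp_add, Real.exp_le_one_iff]; linarith
        have h2 : 0 ≤ s ^ (s / 2) := by positivity
        nlinarith [mul_le_mul_of_nonneg_left h1 h2]

/-- Gaussian moments of an `ℓ_r` combination of linear functionals, for moment order `s ≥ r`. -/
theorem lintegral_sum_abs_inner_rpow_le {ι : Type*} (J : Finset ι) (u : ι → V) {r s : ℝ}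
    (hr : 0 < r) (hrs : r ≤ s) :
    ∫⁻ v, ENNReal.ofReal ((∑ j ∈ J, |inner ℝ (u j) v| ^ r) ^ (s / r)) ∂(gaussianVolume V) ≤
      ENNReal.ofReal ((∑ j ∈ J, ‖u j‖ ^ r) ^ (s / r) * (2 * s ^ (s / 2))) *
        gaussianVolume V Set.univ := by
  have hs : 0 < s := hr.trans_le hrs
  set B := ∑ j ∈ J, ‖u j‖ ^ r with hB
  have hB0 : 0 ≤ B := Finset.sum_nonneg fun j _ => by positivity
  have hz : ∀ j v, |inner ℝ (u j) v| ^ r = ‖u j‖ ^ r * |inner ℝ (‖u j‖⁻¹ • u j) v| ^ r := by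
    intro j v
    rw [← Real.mul_rpow (norm_nonneg _) (abs_nonneg _), real_inner_smul_left, abs_mul, abs_inv,
      abs_norm]
    by_cases h : ‖u j‖ = 0
    · simp [norm_eq_zero.1 h]
    · rw [mul_inv_cancel_left₀ h]
  have hu : ∀ j, ‖‖u j‖⁻¹ • u j‖ ≤ 1 := by
    intro j
    rw [norm_smul, norm_inv, norm_norm]
    exact inv_mul_le_one
  rcases hB0.eq_or_lt with h0 | hpos
  · have : ∀ j ∈ J, ‖u j‖ ^ r = 0 :=
      (Finset.sum_eq_zero_iff_of_nonneg fun j _ => by positivity).1 (hB ▸ h0.symm)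
    have h1 : ∀ v, ∑ j ∈ J, |inner ℝ (u j) v| ^ r = 0 := fun v =>
      Finset.sum_eq_zero fun j hj => by rw [hz, this j hj, zero_mul]
    simp [h1, Real.zero_rpow (div_pos hs hr).ne']
  -- Jensen for the convex power s/r ≥ 1, with weights ‖u_j‖^r / B, reduces the moment to those of
  -- normalized functionals.
  · have hpt : ∀ v, (∑ j ∈ J, |inner ℝ (u j) v| ^ r) ^ (s / r) ≤
        ∑ j ∈ J, B ^ (s / r) * (‖u j‖ ^ r / B) * |inner ℝ (‖u j‖⁻¹ • u j) v| ^ s := by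
      intro v
      have h1 : ∑ j ∈ J, |inner ℝ (u j) v| ^ r =
          B * ∑ j ∈ J, (‖u j‖ ^ r / B) * |inner ℝ (‖u j‖⁻¹ • u j) v| ^ r := by
        rw [Finset.mul_sum]
        refine Finset.sum_congr rfl fun j _ => ?_
        rw [hz]; field_simp
      have h2 := Real.rpow_arith_mean_le_arith_mean_rpow J (fun j => ‖u j‖ ^ r / B)
        (fun j => |inner ℝ (‖u j‖⁻¹ • u j) v| ^ r) (fun j _ => by positivity)
        (by rw [← Finset.sum_div, ← hB, div_self hpos.ne']) (fun j _ => by positivity)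
        ((one_le_div hr).2 hrs)
      rw [h1, Real.mul_rpow hB0 (Finset.sum_nonneg fun j _ => by positivity)]
      refine (mul_le_mul_of_nonneg_left h2 (by positivity)).trans_eq ?_
      rw [Finset.mul_sum]
      refine Finset.sum_congr rfl fun j _ => ?_
      rw [← Real.rpow_mul (abs_nonneg _), mul_div_cancel₀ _ hr.ne', mul_assoc]
    calc _ ≤ ∫⁻ v, ∑ j ∈ J, ENNReal.ofReal (B ^ (s / r) * (‖u j‖ ^ r / B)) *
          ENNReal.ofReal (|inner ℝ (‖u j‖⁻¹ • u j) v| ^ s) ∂(gaussianVolume V) := by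
          refine lintegral_mono fun v => ?_
          refine (ENNReal.ofReal_le_ofReal (hpt v)).trans_eq ?_
          rw [ENNReal.ofReal_sum_of_nonneg fun j _ => by positivity]
          refine Finset.sum_congr rfl fun j _ => ?_
          rw [ENNReal.ofReal_mul (by positivity)]
      _ ≤ ∑ j ∈ J, ENNReal.ofReal (B ^ (s / r) * (‖u j‖ ^ r / B)) *
          (ENNReal.ofReal (2 * s ^ (s / 2)) * gaussianVolume V Set.univ) := by
          rw [lintegral_finsetSum _ fun j _ => by fun_prop]
          refine Finset.sum_le_sum fun j _ => ?_
          rw [lintegral_const_mul _ (by fun_prop)]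
          gcongr
          exact lintegral_abs_inner_rpow_le hs _ (hu j)
      _ = _ := by
          rw [← Finset.sum_mul, ← ENNReal.ofReal_sum_of_nonneg fun j _ => by positivity,
            ← Finset.mul_sum, ← Finset.sum_div, ← hB, div_self hpos.ne', mul_one, ← mul_assoc,
            ← ENNReal.ofReal_mul (by positivity)]

/-- Points whose shifts of a symmetric set of at least half the Gaussian measure are disjoint:
a ball contains few of them. -/
theorem card_le_of_disjoint_shifts {K : Set V} (hK : MeasurableSet K)
    (hsymm : ∀ v, -v ∈ K ↔ v ∈ K) (hhalf : gaussianVolume V Set.univ ≤ 2 * gaussianVolume V K)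
    (T : Finset V) (c : V) {ρ t : ℝ} (hρ : 0 ≤ ρ) (hT : ∀ x ∈ T, ‖x - c‖ ≤ t)
    (hsep : ∀ x ∈ T, ∀ y ∈ T, x ≠ y → ∀ a ∈ K, ∀ b ∈ K, ρ • (x - y) ≠ a - b) :
    (T.card : ℝ) ≤ 2 * Real.exp ((ρ * t) ^ 2 / 2) := by
  have hne := gaussianVolume_univ_ne_zero (V := V)
  have htop := gaussianVolume_univ_ne_top (V := V)
  -- The shifts of K by ρ(x - c) are disjoint, and each has mass at least exp(-(ρt)²/2) γ(K), while
  -- the total mass is at most 2 γ(K).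
  have hdisj : Set.PairwiseDisjoint (↑T) fun x : V => {v | v - ρ • (x - c) ∈ K} := by
    intro x hx y hy hxy
    rw [Function.onFun, Set.disjoint_left]
    intro v hvx hvy
    refine hsep x hx y hy hxy _ hvy _ hvx ?_
    module
  have hmeas : ∀ x ∈ T, MeasurableSet {v | v - ρ • (x - c) ∈ K} := fun x _ =>
    measurable_sub_const _ hK
  have h1 : (T.card : ENNReal) * (ENNReal.ofReal (Real.exp (-(ρ * t) ^ 2 / 2)) *
      gaussianVolume V K) ≤ gaussianVolume V Set.univ := by
    calc _ = ∑ x ∈ T, ENNReal.ofReal (Real.exp (-(ρ * t) ^ 2 / 2)) * gaussianVolume V K := by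
          rw [Finset.sum_const, nsmul_eq_mul]
      _ ≤ ∑ x ∈ T, gaussianVolume V {v | v - ρ • (x - c) ∈ K} := by
          refine Finset.sum_le_sum fun x hx => ?_
          refine le_trans ?_ (gaussianVolume_shift_le hK hsymm (ρ • (x - c)))
          gcongr
          rw [norm_smul, Real.norm_of_nonneg hρ]
          gcongr
          exact hT x hx
      _ = gaussianVolume V (⋃ x ∈ T, {v | v - ρ • (x - c) ∈ K}) :=
          (measure_biUnion_finset hdisj hmeas).symm
      _ ≤ _ := measure_mono (Set.subset_univ _)
  have h2 : (T.card : ENNReal) * ENNReal.ofReal (Real.exp (-(ρ * t) ^ 2 / 2)) *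
      gaussianVolume V Set.univ ≤ 2 * gaussianVolume V Set.univ := by
    calc _ ≤ (T.card : ENNReal) * ENNReal.ofReal (Real.exp (-(ρ * t) ^ 2 / 2)) *
          (2 * gaussianVolume V K) := by gcongr
      _ = 2 * ((T.card : ENNReal) * (ENNReal.ofReal (Real.exp (-(ρ * t) ^ 2 / 2)) *
          gaussianVolume V K)) := by ring
      _ ≤ _ := by gcongr
  rw [ENNReal.mul_le_mul_iff_left hne htop, ← ENNReal.ofReal_natCast,
    ← ENNReal.ofReal_mul (Nat.cast_nonneg _), ← ENNReal.ofReal_ofNat 2,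
    ENNReal.ofReal_le_ofReal_iff (by norm_num)] at h2
  have h3 : Real.exp (-(ρ * t) ^ 2 / 2) * Real.exp ((ρ * t) ^ 2 / 2) = 1 := by
    rw [← Real.exp_add, Real.exp_eq_one_iff]; ring
  calc (T.card : ℝ) = T.card * Real.exp (-(ρ * t) ^ 2 / 2) * Real.exp ((ρ * t) ^ 2 / 2) := by
        rw [mul_assoc, h3, mul_one]
    _ ≤ _ := by gcongr

end Gaussian

/-! ### Gauge families: interpolation, one-scale packing, iteration over scales -/

section Covering

/-- A separated set of maximal cardinality is a net: a point farther than η from all of it could be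
added. The bound B guarantees that a maximum exists. -/
theorem exists_cover_of_packing {V : Type*} [NormedAddCommGroup V] {X : Set V} {η B : ℝ} (hη : 0 ≤ η)
    (h : ∀ T : Finset V, (∀ x ∈ T, x ∈ X) → (∀ x ∈ T, ∀ y ∈ T, x ≠ y → η < ‖x - y‖) →
      (T.card : ℝ) ≤ B) :
    ∃ T : Finset V, (T.card : ℝ) ≤ B ∧ ∀ x ∈ X, ∃ c ∈ T, ‖x - c‖ ≤ η := by
  classical
  let S : Set ℕ := {N | ∃ T : Finset V, (∀ x ∈ T, x ∈ X) ∧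
    (∀ x ∈ T, ∀ y ∈ T, x ≠ y → η < ‖x - y‖) ∧ T.card = N}
  have hne : S.Nonempty := ⟨0, ∅, by simp, by simp, rfl⟩
  have hbdd : BddAbove S := by
    refine ⟨⌊B⌋₊, ?_⟩
    rintro N ⟨T, h1, h2, rfl⟩
    exact Nat.le_floor (h T h1 h2)
  obtain ⟨T, h1, h2, h3⟩ := Nat.sSup_mem hne hbdd
  refine ⟨T, h T h1 h2, fun x hx => ?_⟩
  by_contra! hcon
  have hxT : x ∉ T := fun hxT => by
    have := hcon x hxT
    rw [sub_self, norm_zero] at this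
    linarith
  have hmem : (insert x T).card ∈ S := by
    refine ⟨insert x T, ?_, ?_, rfl⟩
    · intro y hy
      rcases Finset.mem_insert.1 hy with rfl | hy
      exacts [hx, h1 y hy]
    · intro y hy z hz hyz
      rcases Finset.mem_insert.1 hy with rfl | hy' <;>
        rcases Finset.mem_insert.1 hz with rfl | hz'
      · exact absurd rfl hyz
      · exact hcon z hz'
      · rw [norm_sub_rev]; exact hcon y hy'
      · exact h2 y hy' z hz' hyz
  have := le_csSup hbdd hmem
  rw [Finset.card_insert_of_notMem hxT] at this
  omega

variable {V : Type*} [NormedAddCommGroup V] [InnerProductSpace ℝ V] {ι : Type*} [Fintype ι]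

/-- The weighted power sum `∑ i, lam i * f i y ^ r`. -/
noncomputable def gaugeSum (lam : ι → ℝ) (f : ι → V → ℝ) (r : ℝ) (y : V) : ℝ :=
  ∑ i, lam i * f i y ^ r

/-- A weighted family of quasi-norms, dominated individually by the Euclidean norm, and dominating
it in quadratic mean. -/
structure IsGaugeFamily (lam : ι → ℝ) (f : ι → V → ℝ) (F κ : ℝ) : Prop where
  lam_pos : ∀ i, 0 < lam i
  lam_sum : ∑ i, lam i = 1
  F_pos : 0 < F
  one_le : 1 ≤ κ
  nonneg : ∀ i y, 0 ≤ f i y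
  smul : ∀ i (c : ℝ) y, f i (c • y) = |c| * f i y
  sub_le : ∀ i x y, f i (x - y) ≤ κ * max (f i x) (f i y)
  le_norm : ∀ i y, f i y ≤ √F * ‖y‖
  norm_sq_le : ∀ y, ‖y‖ ^ 2 ≤ ∑ i, lam i * f i y ^ (2 : ℝ)
  cont : ∀ i, Continuous (f i)

/-- The constant in the one-scale packing bound. -/
noncomputable def stepConst (p κ : ℝ) : ℝ :=
  16 * (128 * κ ^ 2 + 4) * (2 * κ ^ 2) ^ (2 / (2 - p))

namespace IsGaugeFamily

variable {lam : ι → ℝ} {f : ι → V → ℝ} {F κ : ℝ}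

theorem gaugeSum_nonneg (h : IsGaugeFamily lam f F κ) (r : ℝ) (y : V) : 0 ≤ gaugeSum lam f r y :=
  Finset.sum_nonneg fun i _ => mul_nonneg (h.lam_pos i).le (Real.rpow_nonneg (h.nonneg i y) r)

theorem gaugeSum_smul (h : IsGaugeFamily lam f F κ) (r c : ℝ) (y : V) :
    gaugeSum lam f r (c • y) = |c| ^ r * gaugeSum lam f r y := by
  unfold gaugeSum
  rw [Finset.mul_sum]
  refine Finset.sum_congr rfl fun i _ => ?_
  rw [h.smul, Real.mul_rpow (abs_nonneg c) (h.nonneg i y)]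
  ring

theorem gaugeSum_sub_le (h : IsGaugeFamily lam f F κ) {r : ℝ} (hr : 0 ≤ r) (x y : V) :
    gaugeSum lam f r (x - y) ≤ κ ^ r * (gaugeSum lam f r x + gaugeSum lam f r y) := by
  unfold gaugeSum
  rw [← Finset.sum_add_distrib, Finset.mul_sum]
  refine Finset.sum_le_sum fun i _ => ?_
  have hκ : 0 ≤ κ := zero_le_one.trans h.one_le
  have hl := (h.lam_pos i).le
  have hx := Real.rpow_nonneg (h.nonneg i x) r
  have hy := Real.rpow_nonneg (h.nonneg i y) r
  have h1 : f i (x - y) ^ r ≤ κ ^ r * (f i x ^ r + f i y ^ r) := by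
    refine (Real.rpow_le_rpow (h.nonneg i _) (h.sub_le i x y) hr).trans ?_
    rw [Real.mul_rpow hκ (le_max_of_le_left (h.nonneg i x))]
    refine mul_le_mul_of_nonneg_left ?_ (Real.rpow_nonneg hκ r)
    rcases max_cases (f i x) (f i y) with ⟨e, -⟩ | ⟨e, -⟩ <;> rw [e] <;> linarith
  calc _ ≤ lam i * (κ ^ r * (f i x ^ r + f i y ^ r)) := mul_le_mul_of_nonneg_left h1 hl
    _ = _ := by ring

/-- Interpolation of the quadratic mean between the exponents `p < 2 < s`. -/
theorem norm_sq_le_interpolation (h : IsGaugeFamily lam f F κ) {p s : ℝ} (hp : p < 2)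
    (hs : 2 < s) (y : V) :
    ‖y‖ ^ 2 ≤ gaugeSum lam f p y ^ ((s - 2) / (s - p)) *
      gaugeSum lam f s y ^ ((2 - p) / (s - p)) := by
  have hsp : 0 < s - p := by linarith
  have hα : 0 < (s - 2) / (s - p) := div_pos (by linarith) hsp
  have hβ : 0 < (2 - p) / (s - p) := div_pos (by linarith) hsp
  set α := (s - 2) / (s - p) with hαd
  set β := (2 - p) / (s - p) with hβd
  have hαβ : α + β = 1 := by rw [hαd, hβd]; field_simp; ring
  -- Together with α + β = 1, this makes λ_i f_i² the product of (λ_i f_i^p)^α and (λ_i f_i^s)^β, so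
  -- Hölder with exponents 1/α and 1/β applies.
  have hexp : p * α + s * β = 2 := by rw [hαd, hβd]; field_simp; ring
  have hconj : (α⁻¹).HolderConjugate β⁻¹ := Real.HolderConjugate.inv_inv hα hβ hαβ
  refine (h.norm_sq_le y).trans ?_
  have hH := Real.inner_le_Lp_mul_Lq_of_nonneg Finset.univ hconj
    (f := fun i => (lam i * f i y ^ p) ^ α) (g := fun i => (lam i * f i y ^ s) ^ β)
    (fun i _ => Real.rpow_nonneg (mul_nonneg (h.lam_pos i).le (Real.rpow_nonneg (h.nonneg i y) _)) _)
    (fun i _ => Real.rpow_nonneg (mul_nonneg (h.lam_pos i).le (Real.rpow_nonneg (h.nonneg i y) _)) _)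
  simp only [one_div, inv_inv] at hH
  refine le_trans (Finset.sum_le_sum fun i _ => ?_) (hH.trans_eq ?_)
  · have hl := (h.lam_pos i)
    have hf := h.nonneg i y
    rw [Real.mul_rpow hl.le (Real.rpow_nonneg hf _), Real.mul_rpow hl.le (Real.rpow_nonneg hf _),
      ← Real.rpow_mul hf, ← Real.rpow_mul hf]
    have h1 : lam i ^ α * lam i ^ β = lam i := by
      rw [← Real.rpow_add hl, hαβ, Real.rpow_one]
    rcases hf.eq_or_lt with h0 | hpos
    · rw [← h0, Real.zero_rpow two_ne_zero, mul_zero]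
      positivity
    · have h2 : f i y ^ (p * α) * f i y ^ (s * β) = f i y ^ (2 : ℝ) := by
        rw [← Real.rpow_add hpos, hexp]
      rw [← h2]
      nth_rewrite 1 [← h1]
      apply le_of_eq; ring
  · unfold gaugeSum
    congr 2 <;> refine Finset.sum_congr rfl fun i _ => ?_
    · rw [← Real.rpow_mul (mul_nonneg (h.lam_pos i).le (Real.rpow_nonneg (h.nonneg i y) _)),
        mul_inv_cancel₀ hα.ne', Real.rpow_one]
    · rw [← Real.rpow_mul (mul_nonneg (h.lam_pos i).le (Real.rpow_nonneg (h.nonneg i y) _)),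
        mul_inv_cancel₀ hβ.ne', Real.rpow_one]

/-- Writing f_i² = f_i^{2-p} f_i^p and bounding the first factor by (√F ‖y‖)^{2-p} gives ‖y‖² ≤ (√F
‖y‖)^{2-p}, which is solved for ‖y‖. This is the radius at which the iteration starts. -/
theorem norm_le_of_gaugeSum_le_one (h : IsGaugeFamily lam f F κ) {p : ℝ} (hp0 : 0 < p)
    (hp : p < 2) {y : V} (hy : gaugeSum lam f p y ≤ 1) :
    ‖y‖ ≤ F ^ ((2 - p) / (2 * p)) := by
  rcases (norm_nonneg y).eq_or_lt with h0 | hpos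
  · rw [← h0]; exact Real.rpow_nonneg h.F_pos.le _
  have h2p : 0 < 2 - p := by linarith
  have h1 : ‖y‖ ^ 2 ≤ (√F * ‖y‖) ^ (2 - p) := by
    calc ‖y‖ ^ 2 ≤ ∑ i, lam i * f i y ^ (2 : ℝ) := h.norm_sq_le y
      _ ≤ ∑ i, (√F * ‖y‖) ^ (2 - p) * (lam i * f i y ^ p) := by
          refine Finset.sum_le_sum fun i _ => ?_
          have hf := h.nonneg i y
          have e : f i y ^ (2 : ℝ) = f i y ^ (2 - p) * f i y ^ p := by
            rw [← Real.rpow_add_of_nonneg hf h2p.le hp0.le]; congr 1; ring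
          have := Real.rpow_le_rpow hf (h.le_norm i y) h2p.le
          have hl := (h.lam_pos i).le
          rw [e]
          calc lam i * (f i y ^ (2 - p) * f i y ^ p) = f i y ^ (2 - p) * (lam i * f i y ^ p) := by ring
            _ ≤ _ := by gcongr
      _ = (√F * ‖y‖) ^ (2 - p) * gaugeSum lam f p y := by rw [gaugeSum, Finset.mul_sum]
      _ ≤ _ := mul_le_of_le_one_right (by positivity) hy
  have h2 : ‖y‖ ^ p ≤ F ^ ((2 - p) / 2) := by
    rw [Real.mul_rpow (Real.sqrt_nonneg F) hpos.le, Real.sqrt_eq_rpow, ← Real.rpow_mul h.F_pos.le]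
      at h1
    have e : ‖y‖ ^ 2 = ‖y‖ ^ p * ‖y‖ ^ (2 - p) := by
      rw [← Real.rpow_add hpos, ← Real.rpow_natCast]; congr 1; push_cast; ring
    rw [e] at h1
    have := le_of_mul_le_mul_right h1 (Real.rpow_pos_of_pos hpos _)
    rwa [one_div_mul_eq_div] at this
  have h3 := Real.rpow_le_rpow (by positivity) h2 (inv_pos.2 hp0).le
  rw [← Real.rpow_mul hpos.le, mul_inv_cancel₀ hp0.ne', Real.rpow_one, ← Real.rpow_mul h.F_pos.le]
    at h3
  convert h3 using 2
  field_simp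

variable [FiniteDimensional ℝ V] [MeasurableSpace V] [BorelSpace V]

/-- A dual Sudakov inequality for the quasi-norm `gaugeSum lam f s ^ (1 / s)`. -/
theorem card_le_of_gaugeSum_separated (h : IsGaugeFamily lam f F κ) {s : ℝ} (hs : 1 ≤ s)
    (hmom : ∫⁻ v, ENNReal.ofReal (gaugeSum lam f s v) ∂(gaussianVolume V) ≤
      ENNReal.ofReal ((4 * √(F * s)) ^ s) * gaussianVolume V Set.univ)
    (T : Finset V) (c : V) {t δ : ℝ} (ht : 0 < t) (hδ : 0 < δ) (hT : ∀ x ∈ T, ‖x - c‖ ≤ t)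
    (hsep : ∀ x ∈ T, ∀ y ∈ T, x ≠ y → δ ^ s < gaugeSum lam f s (x - y)) :
    (T.card : ℝ) ≤ Real.exp ((128 * κ ^ 2 + 4) * (F * s) * (t / δ) ^ 2) := by
  have hs0 : 0 < s := by linarith
  have hF := h.F_pos
  have hκ : 0 < κ := zero_lt_one.trans_le h.one_le
  -- Here the ball has G_s^{1/s}-diameter at most 2t√F ≤ δ, so it holds at most one separated point.
  -- In the other case the exponent is large enough to absorb the factor 2 of the packing bound.
  by_cases hsmall : 4 * F * (t / δ) ^ 2 ≤ 1
  · have h1 : T.card ≤ 1 := by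
      rw [Finset.card_le_one]
      intro x hx y hy
      by_contra hxy
      have hn : ‖x - y‖ ≤ 2 * t := by
        have := norm_sub_le (x - c) (y - c)
        rw [sub_sub_sub_cancel_right] at this
        linarith [hT x hx, hT y hy]
      have hb : √F * (2 * t) ≤ δ := by
        apply le_of_sq_le_sq _ hδ.le
        rw [mul_pow, Real.sq_sqrt hF.le]
        rw [div_pow, mul_div_assoc', div_le_one (by positivity)] at hsmall
        linarith
      refine (hsep x hx y hy hxy).not_ge ?_
      calc gaugeSum lam f s (x - y) ≤ ∑ i, lam i * δ ^ s := by
            refine Finset.sum_le_sum fun i _ => ?_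
            refine mul_le_mul_of_nonneg_left ?_ (h.lam_pos i).le
            refine Real.rpow_le_rpow (h.nonneg i _) ?_ hs0.le
            exact (h.le_norm i _).trans ((mul_le_mul_of_nonneg_left hn (Real.sqrt_nonneg F)).trans hb)
        _ = δ ^ s := by rw [← Finset.sum_mul, h.lam_sum, one_mul]
    calc (T.card : ℝ) ≤ 1 := by exact_mod_cast h1
      _ ≤ _ := Real.one_le_exp (by positivity)
  · push Not at hsmall
    set m := 4 * √(F * s) with hm
    have hm0 : 0 < m := by positivity
    have hmeas : Measurable (gaugeSum lam f s : V → ℝ) := by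
      unfold gaugeSum
      exact Finset.measurable_fun_sum _ fun i _ => ((h.cont i).measurable.pow_const s).const_mul _
    let K : Set V := {v | gaugeSum lam f s v < 2 * m ^ s}
    have hK : MeasurableSet K := measurableSet_lt hmeas measurable_const
    have hsymm : ∀ v, -v ∈ K ↔ v ∈ K := by
      intro v
      have := h.gaugeSum_smul s (-1) v
      rw [neg_one_smul, abs_neg, abs_one, Real.one_rpow, one_mul] at this
      simp only [K, Set.mem_ofPred_eq, this]
    have hms : 0 < m ^ s := Real.rpow_pos_of_pos hm0 s
    -- Markov's inequality: the complement of K has at most half of the total mass.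
    have hhalf : gaussianVolume V Set.univ ≤ 2 * gaussianVolume V K := by
      have h1 := mul_meas_ge_le_lintegral (μ := gaussianVolume V) hmeas.ennreal_ofReal
        (ENNReal.ofReal (2 * m ^ s))
      have hc : {v | ENNReal.ofReal (2 * m ^ s) ≤ ENNReal.ofReal (gaugeSum lam f s v)} = Kᶜ := by
        ext v
        simp only [K, Set.mem_ofPred_eq, Set.mem_compl_iff, not_lt]
        exact ENNReal.ofReal_le_ofReal_iff (h.gaugeSum_nonneg s v)
      rw [hc, ENNReal.ofReal_mul (by norm_num), mul_right_comm, mul_comm _ (ENNReal.ofReal (m ^ s))]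
        at h1
      have h2 := (ENNReal.mul_le_mul_iff_right (ENNReal.ofReal_pos.2 hms).ne'
        ENNReal.ofReal_ne_top).1 (h1.trans hmom)
      rw [ENNReal.ofReal_ofNat] at h2
      have h3 := measure_add_measure_compl (μ := gaussianVolume V) hK
      have htop : gaussianVolume V Kᶜ ≠ ⊤ :=
        ((measure_mono (Set.subset_univ _)).trans_lt
          (gaussianVolume_univ_ne_top (V := V)).lt_top).ne
      rw [← h3] at h2 ⊢
      rw [two_mul] at h2 ⊢
      have h4 := (ENNReal.add_le_add_iff_right htop).1 h2
      gcongr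
    -- The dilation is chosen so that (ρδ)^s = (4κm)^s ≥ 4 κ^s m^s, which bounds G_s on differences
    -- of points of K; thus separated points have disjoint shifts.
    have hρ : 0 ≤ 4 * κ * m / δ := by positivity
    have h1 := card_le_of_disjoint_shifts hK hsymm hhalf T c hρ hT ?_
    · have h2 : (4 * κ * m / δ * t) ^ 2 / 2 = 128 * κ ^ 2 * (F * s) * (t / δ) ^ 2 := by
        rw [hm]
        have := Real.sq_sqrt (show 0 ≤ F * s by positivity)
        field_simp
        rw [this]
        ring
      have h3 : (2 : ℝ) ≤ Real.exp (4 * (F * s) * (t / δ) ^ 2) := by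
        have : 1 ≤ 4 * (F * s) * (t / δ) ^ 2 := by nlinarith
        linarith [Real.add_one_le_exp (4 * (F * s) * (t / δ) ^ 2)]
      rw [h2] at h1
      refine h1.trans ?_
      calc _ ≤ Real.exp (4 * (F * s) * (t / δ) ^ 2) *
            Real.exp (128 * κ ^ 2 * (F * s) * (t / δ) ^ 2) := by gcongr
        _ = _ := by rw [← Real.exp_add]; congr 1; ring
    · intro x hx y hy hxy a ha b hb hab
      have h2 := h.gaugeSum_sub_le hs0.le a b
      rw [← hab, h.gaugeSum_smul, abs_of_nonneg hρ] at h2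
      have h3 := hsep x hx y hy hxy
      have h4 : (4 * κ * m / δ) ^ s * δ ^ s = 4 ^ s * (κ ^ s * m ^ s) := by
        rw [← Real.mul_rpow hρ hδ.le, div_mul_cancel₀ _ hδ.ne', ← Real.mul_rpow hκ.le hm0.le,
          ← Real.mul_rpow (by norm_num) (by positivity), mul_assoc]
      have h5 : κ ^ s * (gaugeSum lam f s a + gaugeSum lam f s b) ≤ κ ^ s * (4 * m ^ s) := by
        have ha' : gaugeSum lam f s a < 2 * m ^ s := ha
        have hb' : gaugeSum lam f s b < 2 * m ^ s := hb
        gcongr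
        linarith
      have h6 : (4 : ℝ) ≤ 4 ^ s := by
        simpa using Real.rpow_le_rpow_of_exponent_le (by norm_num : (1 : ℝ) ≤ 4) hs
      have hρ' : 0 < (4 * κ * m / δ) ^ s := by positivity
      have h7 := mul_lt_mul_of_pos_left h3 hρ'
      have hκm : 0 < κ ^ s * m ^ s := by positivity
      nlinarith [mul_le_mul_of_nonneg_right h6 hκm.le]

/-- Interpolation converts Euclidean separation inside {G_p ≤ 1} into G_s-separation, to which dual
Sudakov applies. The assumptions on η and F keep the surplus power of η bounded. -/
theorem card_le_of_norm_separated (h : IsGaugeFamily lam f F κ) {p s : ℝ} (hp0 : 0 < p)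
    (hp : p < 2) (hs : 2 < s) (hFs : F ≤ 2 ^ s)
    (hmom : ∫⁻ v, ENNReal.ofReal (gaugeSum lam f s v) ∂(gaussianVolume V) ≤
      ENNReal.ofReal ((4 * √(F * s)) ^ s) * gaussianVolume V Set.univ)
    (T : Finset V) (c : V) {η : ℝ} (hη : 0 < η) (hηF : η ≤ F ^ ((2 - p) / (2 * p)))
    (hTp : ∀ x ∈ T, gaugeSum lam f p x ≤ 1) (hT : ∀ x ∈ T, ‖x - c‖ ≤ 2 * η)
    (hsep : ∀ x ∈ T, ∀ y ∈ T, x ≠ y → η < ‖x - y‖) :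
    (T.card : ℝ) ≤ Real.exp (stepConst p κ * (F * s) * η ^ (-(2 * p / (2 - p)))) := by
  have hκ1 := h.one_le
  have hκ : 0 < κ := zero_lt_one.trans_le hκ1
  have h2p : 0 < 2 - p := by linarith
  have hsp : 0 < s - p := by linarith
  have hs0 : 0 < s := by linarith
  have hF := h.F_pos
  have hc1 : 1 ≤ 2 * κ ^ 2 := by nlinarith
  have hc : 0 < 2 * κ ^ 2 := by positivity
  -- The exponent for which (δ^s)^{(2-p)/(s-p)} = η²/(2κ²); here 2κ² bounds G_p on differences.
  set b := (s - p) / (s * (2 - p)) with hb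
  set δ := (η ^ 2 / (2 * κ ^ 2)) ^ b with hδd
  have hδ : 0 < δ := by positivity
  have h1 := h.card_le_of_gaugeSum_separated (by linarith) hmom T c (by positivity) hδ hT ?_
  · refine h1.trans (Real.exp_le_exp.2 ?_)
    have h2 : (2 * η / δ) ^ 2 = 4 * (η ^ (-(2 * p / (2 - p))) * η ^ (4 * p / (s * (2 - p))) *
        (2 * κ ^ 2) ^ (2 * b)) := by
      have e1 : δ ^ 2 = η ^ (4 * b) / (2 * κ ^ 2) ^ (2 * b) := by
        rw [hδd, ← Real.rpow_natCast, ← Real.rpow_mul (by positivity),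
          Real.div_rpow (by positivity) hc.le, ← Real.rpow_natCast η, ← Real.rpow_mul hη.le]
        push_cast
        congr 2 <;> ring
      have e2 : η ^ (-(2 * p / (2 - p))) * η ^ (4 * p / (s * (2 - p))) * η ^ (4 * b) = η ^ 2 := by
        rw [← Real.rpow_add hη, ← Real.rpow_add hη, ← Real.rpow_natCast]
        congr 1
        rw [hb]; push_cast; field_simp; ring
      have e3 : 0 < (2 * κ ^ 2) ^ (2 * b) := by positivity
      have e4 : 0 < η ^ (4 * b) := by positivity
      rw [div_pow, e1, mul_pow, ← e2]
      field_simp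
      norm_num
    -- The surplus power of η is at most F^{2/s}, and F ≤ 2^s. This is where log F enters the size
    -- of s.
    have h3 : η ^ (4 * p / (s * (2 - p))) ≤ 4 := by
      calc η ^ (4 * p / (s * (2 - p))) ≤ (F ^ ((2 - p) / (2 * p))) ^ (4 * p / (s * (2 - p))) := by
            gcongr
        _ = F ^ (2 / s) := by
            rw [← Real.rpow_mul hF.le]; congr 1; field_simp; norm_num
        _ ≤ (2 ^ s) ^ (2 / s) := by gcongr
        _ = 4 := by
            rw [← Real.rpow_mul (by norm_num), mul_div_cancel₀ _ hs0.ne']; norm_num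
    have h4 : (2 * κ ^ 2) ^ (2 * b) ≤ (2 * κ ^ 2) ^ (2 / (2 - p)) := by
      apply Real.rpow_le_rpow_of_exponent_le hc1
      rw [hb, mul_div_assoc', div_le_div_iff₀ (by positivity) h2p]
      nlinarith
    -- The 16 in `stepConst` is 4 from the radius 2η, squared, times 4 from `h3`.
    rw [h2, stepConst]
    calc _ ≤ (128 * κ ^ 2 + 4) * (F * s) * (4 * (η ^ (-(2 * p / (2 - p))) * 4 *
            (2 * κ ^ 2) ^ (2 / (2 - p)))) := by gcongr
      _ = _ := by ring
  · intro x hx y hy hxy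
    by_contra! hcon
    refine (hsep x hx y hy hxy).not_ge ?_
    apply le_of_sq_le_sq _ hη.le
    have hG : gaugeSum lam f p (x - y) ≤ 2 * κ ^ 2 := by
      refine (h.gaugeSum_sub_le hp0.le x y).trans ?_
      have e : κ ^ p ≤ κ ^ 2 := by
        rw [← Real.rpow_natCast]
        exact Real.rpow_le_rpow_of_exponent_le hκ1 (by push_cast; linarith)
      calc κ ^ p * (gaugeSum lam f p x + gaugeSum lam f p y) ≤ κ ^ 2 * (1 + 1) := by
            have := hTp x hx
            have := hTp y hy
            have := h.gaugeSum_nonneg p x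
            have := h.gaugeSum_nonneg p y
            gcongr
        _ = _ := by ring
    calc ‖x - y‖ ^ 2 ≤ gaugeSum lam f p (x - y) ^ ((s - 2) / (s - p)) *
          gaugeSum lam f s (x - y) ^ ((2 - p) / (s - p)) := h.norm_sq_le_interpolation hp hs _
      _ ≤ (2 * κ ^ 2) ^ ((s - 2) / (s - p)) * (δ ^ s) ^ ((2 - p) / (s - p)) := by
          have := h.gaugeSum_nonneg p (x - y)
          have := h.gaugeSum_nonneg s (x - y)
          have : 0 ≤ (s - 2) / (s - p) := div_nonneg (by linarith) hsp.le
          have : 0 ≤ (2 - p) / (s - p) := by positivity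
          gcongr
      _ ≤ (2 * κ ^ 2) ^ (1 : ℝ) * (η ^ 2 / (2 * κ ^ 2)) := by
          have e1 : (δ ^ s) ^ ((2 - p) / (s - p)) = η ^ 2 / (2 * κ ^ 2) := by
            rw [hδd, ← Real.rpow_mul (by positivity), ← Real.rpow_mul (by positivity)]
            have : b * (s * ((2 - p) / (s - p))) = 1 := by rw [hb]; field_simp
            rw [this, Real.rpow_one]
          rw [e1]
          have : (s - 2) / (s - p) ≤ 1 := (div_le_one hsp).2 (by linarith)
          gcongr
      _ = η ^ 2 := by rw [Real.rpow_one]; field_simp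

/-- Each ball of a cover at radius 2η is covered at radius η by the one-scale bound, so the
exponents add along a geometric series of ratio 2^{-a} with a = 2p/(2-p). -/
theorem exists_cover (h : IsGaugeFamily lam f F κ) {p s : ℝ} (hp0 : 0 < p)
    (hp : p < 2) (hs : 2 < s) (hFs : F ≤ 2 ^ s)
    (hmom : ∫⁻ v, ENNReal.ofReal (gaugeSum lam f s v) ∂(gaussianVolume V) ≤
      ENNReal.ofReal ((4 * √(F * s)) ^ s) * gaussianVolume V Set.univ) {η : ℝ} (hη : 0 < η) :
    ∃ T : Finset V, (T.card : ℝ) ≤ Real.exp (stepConst p κ / (1 - 2 ^ (-(2 * p / (2 - p)))) *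
        (F * s) * η ^ (-(2 * p / (2 - p)))) ∧
      ∀ x, gaugeSum lam f p x ≤ 1 → ∃ c ∈ T, ‖x - c‖ ≤ η := by
  classical
  have h2p : 0 < 2 - p := by linarith
  have hF := h.F_pos
  have hκ : 0 < κ := zero_lt_one.trans_le h.one_le
  set a := 2 * p / (2 - p) with ha
  have ha0 : 0 < a := by positivity
  have h2a : (2 : ℝ) ^ (-a) < 1 := Real.rpow_lt_one_of_one_lt_of_neg (by norm_num) (by linarith)
  have hD0 : 0 < stepConst p κ := by unfold stepConst; positivity
  have h1a : 0 < 1 - (2 : ℝ) ^ (-a) := by linarith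
  set D := stepConst p κ / (1 - 2 ^ (-a)) with hD
  have hDpos : 0 < D := by positivity
  -- The fixed-point equation that closes the induction on the number of halvings.
  have hDeq : D * 2 ^ (-a) + stepConst p κ = D := by
    rw [hD]; field_simp; ring
  have hbig : ∀ η : ℝ, 0 < η → F ^ ((2 - p) / (2 * p)) ≤ η →
      ∃ T : Finset V, (T.card : ℝ) ≤ Real.exp (D * (F * s) * η ^ (-a)) ∧
        ∀ x, gaugeSum lam f p x ≤ 1 → ∃ c ∈ T, ‖x - c‖ ≤ η := by
    intro η hη hle
    refine ⟨{0}, ?_, fun x hx => ⟨0, by simp, ?_⟩⟩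
    · rw [Finset.card_singleton, Nat.cast_one]
      exact Real.one_le_exp (by positivity)
    · rw [sub_zero]
      exact (h.norm_le_of_gaugeSum_le_one hp0 hp hx).trans hle
  have main : ∀ (N : ℕ) (η : ℝ), 0 < η → F ^ ((2 - p) / (2 * p)) ≤ 2 ^ N * η →
      ∃ T : Finset V, (T.card : ℝ) ≤ Real.exp (D * (F * s) * η ^ (-a)) ∧
        ∀ x, gaugeSum lam f p x ≤ 1 → ∃ c ∈ T, ‖x - c‖ ≤ η := by
    intro N
    induction N with
    | zero => intro η hη hle; exact hbig η hη (by simpa using hle)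
    | succ N ih =>
      intro η hη hle
      rcases le_total (F ^ ((2 - p) / (2 * p))) η with hcase | hcase
      · exact hbig η hη hcase
      obtain ⟨T₀, hT₀, hcov⟩ := ih (2 * η) (by positivity) (by rw [pow_succ] at hle; linarith)
      have hloc : ∀ c : V, ∃ T : Finset V,
          (T.card : ℝ) ≤ Real.exp (stepConst p κ * (F * s) * η ^ (-a)) ∧
          ∀ x ∈ {x : V | gaugeSum lam f p x ≤ 1 ∧ ‖x - c‖ ≤ 2 * η}, ∃ c ∈ T, ‖x - c‖ ≤ η := by
        intro c
        refine exists_cover_of_packing hη.le fun T hTX hsep => ?_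
        exact h.card_le_of_norm_separated hp0 hp hs hFs hmom T c hη hcase
          (fun x hx => (hTX x hx).1) (fun x hx => (hTX x hx).2) hsep
      choose S hScard hS using hloc
      refine ⟨T₀.biUnion S, ?_, ?_⟩
      · calc ((T₀.biUnion S).card : ℝ) ≤ ∑ c ∈ T₀, ((S c).card : ℝ) := by
              exact_mod_cast Finset.card_biUnion_le
          _ ≤ ∑ _c ∈ T₀, Real.exp (stepConst p κ * (F * s) * η ^ (-a)) :=
              Finset.sum_le_sum fun c _ => hScard c
          _ = T₀.card * Real.exp (stepConst p κ * (F * s) * η ^ (-a)) := by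
              rw [Finset.sum_const, nsmul_eq_mul]
          _ ≤ Real.exp (D * (F * s) * (2 * η) ^ (-a)) *
                Real.exp (stepConst p κ * (F * s) * η ^ (-a)) := by gcongr
          _ = Real.exp (D * (F * s) * η ^ (-a)) := by
              rw [← Real.exp_add, Real.mul_rpow (by norm_num) hη.le]
              congr 1
              nth_rewrite 2 [← hDeq]
              ring
      · intro x hx
        obtain ⟨c, hc, hxc⟩ := hcov x hx
        obtain ⟨d, hd, hxd⟩ := hS c x ⟨hx, hxc⟩
        exact ⟨d, Finset.mem_biUnion.2 ⟨c, hc, hd⟩, hxd⟩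
  obtain ⟨N, hN⟩ := pow_unbounded_of_one_lt (F ^ ((2 - p) / (2 * p)) / η) one_lt_two
  exact main N η hη (by rw [div_lt_iff₀ hη] at hN; exact hN.le)

end IsGaugeFamily

end Covering

/-! ### Comparison of ℓ_q quasi-norms on finite sets -/

section PowerSums

variable {ι : Type*} (J : Finset ι)

theorem sum_abs_rpow_nonneg (q : ℝ) (y : ι → ℝ) : 0 ≤ ∑ j ∈ J, |y j| ^ q :=
  Finset.sum_nonneg fun _ _ => Real.rpow_nonneg (abs_nonneg _) _

theorem abs_le_sum_abs_rpow {r : ℝ} (hr : 0 < r) (y : ι → ℝ) {j : ι} (hj : j ∈ J) :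
    |y j| ≤ (∑ j ∈ J, |y j| ^ r) ^ (1 / r) := by
  have h1 : |y j| ^ r ≤ ∑ j ∈ J, |y j| ^ r :=
    Finset.single_le_sum (f := fun j => |y j| ^ r)
      (fun _ _ => Real.rpow_nonneg (abs_nonneg _) _) hj
  have h2 := Real.rpow_le_rpow (by positivity) h1 (one_div_pos.2 hr).le
  rwa [← Real.rpow_mul (abs_nonneg _), mul_one_div_cancel hr.ne', Real.rpow_one] at h2

theorem sum_abs_rpow_antitone {r q : ℝ} (hr : 0 < r) (hrq : r ≤ q) (y : ι → ℝ) :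
    (∑ j ∈ J, |y j| ^ q) ^ (1 / q) ≤ (∑ j ∈ J, |y j| ^ r) ^ (1 / r) := by
  have hq : 0 < q := hr.trans_le hrq
  have hS := sum_abs_rpow_nonneg J r y
  set Y := (∑ j ∈ J, |y j| ^ r) ^ (1 / r) with hY
  have hY0 : 0 ≤ Y := by positivity
  have hYr : Y ^ r = ∑ j ∈ J, |y j| ^ r := by
    rw [hY, ← Real.rpow_mul hS, one_div_mul_cancel hr.ne', Real.rpow_one]
  have h1 : ∑ j ∈ J, |y j| ^ q ≤ Y ^ q := by
    calc ∑ j ∈ J, |y j| ^ q ≤ ∑ j ∈ J, Y ^ (q - r) * |y j| ^ r := by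
          refine Finset.sum_le_sum fun j hj => ?_
          have h2 : |y j| ^ q = |y j| ^ (q - r) * |y j| ^ r := by
            rw [← Real.rpow_add_of_nonneg (abs_nonneg _) (by linarith) hr.le]; congr 1; ring
          rw [h2]
          have := abs_le_sum_abs_rpow J hr y hj
          have := Real.rpow_le_rpow (abs_nonneg _) this (sub_nonneg.2 hrq)
          gcongr
      _ = Y ^ q := by
          rw [← Finset.mul_sum, ← hYr, ← Real.rpow_add_of_nonneg hY0 (by linarith) hr.le]
          congr 1; ring
  have h2 := Real.rpow_le_rpow (sum_abs_rpow_nonneg J q y) h1 (one_div_pos.2 hq).le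
  rwa [← Real.rpow_mul hY0, mul_one_div_cancel hq.ne', Real.rpow_one] at h2

/-- On a finite set `J` the exponent of an `ℓ_q` quasi-norm may be lowered to `log₂ |J|`. -/
theorem exists_equivalent_exponent (hJ : J.Nonempty) {q : ℝ} (hq : 0 < q) :
    ∃ r : ℝ, 0 < r ∧ r ≤ max 1 (min q (Real.logb 2 (J.card : ℝ))) ∧ ∀ y : ι → ℝ,
      (∑ j ∈ J, |y j| ^ q) ^ (1 / q) ≤ (∑ j ∈ J, |y j| ^ r) ^ (1 / r) ∧
      (∑ j ∈ J, |y j| ^ r) ^ (1 / r) ≤ 2 * (∑ j ∈ J, |y j| ^ q) ^ (1 / q) := by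
  rcases Nat.lt_or_ge J.card 2 with h1 | h2
  · have hc : J.card = 1 := by have := hJ.card_pos; omega
    obtain ⟨j, rfl⟩ := Finset.card_eq_one.1 hc
    -- On a singleton all exponents give the same norm; log 1 = 0 would not be an admissible
    -- exponent.
    refine ⟨1, one_pos, le_max_left _ _, fun y => ?_⟩
    have : (|y j| ^ q) ^ (1 / q) = |y j| := by
      rw [← Real.rpow_mul (abs_nonneg _), mul_one_div_cancel hq.ne', Real.rpow_one]
    simp only [Finset.sum_singleton, this, Real.rpow_one, div_one]
    exact ⟨le_rfl, by linarith [abs_nonneg (y j)]⟩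
  · have hN : (2 : ℝ) ≤ J.card := by exact_mod_cast h2
    set L := Real.logb 2 (J.card : ℝ) with hL
    have hL1 : 1 ≤ L := by
      rw [hL, Real.le_logb_iff_rpow_le (by norm_num) (by linarith)]; simpa using hN
    rcases le_total q L with hqL | hqL
    · refine ⟨q, hq, ?_, fun y => ⟨le_rfl, ?_⟩⟩
      · rw [min_eq_left hqL]; exact le_max_right _ _
      · have : 0 ≤ (∑ j ∈ J, |y j| ^ q) ^ (1 / q) :=
          Real.rpow_nonneg (sum_abs_rpow_nonneg J q y) _
        linarith
    · have hL0 : 0 < L := by linarith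
      refine ⟨L, hL0, ?_, fun y => ⟨sum_abs_rpow_antitone J hL0 hqL y, ?_⟩⟩
      · rw [min_eq_right hqL]; exact le_max_right _ _
      · set Y := (∑ j ∈ J, |y j| ^ q) ^ (1 / q)
        have hY : 0 ≤ Y := Real.rpow_nonneg (sum_abs_rpow_nonneg J q y) _
        have h3 : ∑ j ∈ J, |y j| ^ L ≤ J.card * Y ^ L := by
          rw [← nsmul_eq_mul]
          refine Finset.sum_le_card_nsmul _ _ _ fun j hj => ?_
          exact Real.rpow_le_rpow (abs_nonneg _) (abs_le_sum_abs_rpow J hq y hj) hL0.le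
        -- The loss N^{1/L} is exactly 2 at L = log₂ N.
        have h4 : (J.card : ℝ) = 2 ^ L := by
          rw [hL, Real.rpow_logb (by norm_num) (by norm_num) (by linarith)]
        rw [h4, ← Real.mul_rpow (by norm_num) hY] at h3
        have h5 := Real.rpow_le_rpow (sum_abs_rpow_nonneg J L y) h3 (one_div_pos.2 hL0).le
        rwa [← Real.rpow_mul (by positivity), mul_one_div_cancel hL0.ne', Real.rpow_one] at h5

/-- A quasi-triangle inequality with maximum, valid also for q < 1. The factor 2^{1/q} arises only
when there are at least two terms, so `q₀` need not bound the exponents of singletons. -/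
theorem sum_abs_sub_rpow_le {q q₀ : ℝ} (hq : 0 < q) (hq₀ : 0 < q₀)
    (hJ : 2 ≤ J.card → q₀ ≤ q) (x y : ι → ℝ) :
    (∑ j ∈ J, |x j - y j| ^ q) ^ (1 / q) ≤ 2 * 2 ^ (1 / q₀) *
      max ((∑ j ∈ J, |x j| ^ q) ^ (1 / q)) ((∑ j ∈ J, |y j| ^ q) ^ (1 / q)) := by
  have hpt : ∀ j, |x j - y j| ≤ 2 * max |x j| |y j| := fun j => by
    have := abs_sub (x j) (y j)
    have := le_max_left |x j| |y j|
    have := le_max_right |x j| |y j|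
    linarith
  have h2q : (1 : ℝ) ≤ 2 ^ (1 / q₀) := Real.one_le_rpow (by norm_num) (by positivity)
  rcases Nat.lt_or_ge J.card 2 with h1 | h2
  · rcases Nat.eq_zero_or_pos J.card with h0 | hpos
    · rw [Finset.card_eq_zero] at h0
      simp [h0, Real.zero_rpow (inv_pos.2 hq).ne']
    · obtain ⟨j, rfl⟩ := Finset.card_eq_one.1 (show J.card = 1 by omega)
      have : ∀ z : ℝ, (|z| ^ q) ^ (1 / q) = |z| := fun z => by
        rw [← Real.rpow_mul (abs_nonneg _), mul_one_div_cancel hq.ne', Real.rpow_one]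
      simp only [Finset.sum_singleton, this]
      refine (hpt j).trans ?_
      gcongr
      linarith
  · have hqq := hJ h2
    have hX := sum_abs_rpow_nonneg J q x
    have hY := sum_abs_rpow_nonneg J q y
    set X := ∑ j ∈ J, |x j| ^ q
    set Y := ∑ j ∈ J, |y j| ^ q
    have hM : 0 ≤ max X Y := le_max_of_le_left hX
    have h3 : ∑ j ∈ J, |x j - y j| ^ q ≤ 2 ^ q * (2 * max X Y) := by
      calc ∑ j ∈ J, |x j - y j| ^ q ≤ ∑ j ∈ J, 2 ^ q * (|x j| ^ q + |y j| ^ q) := by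
            refine Finset.sum_le_sum fun j _ => ?_
            refine (Real.rpow_le_rpow (abs_nonneg _) (hpt j) hq.le).trans ?_
            rw [Real.mul_rpow (by norm_num) (le_max_of_le_left (abs_nonneg _))]
            have hx := Real.rpow_nonneg (abs_nonneg (x j)) q
            have hy := Real.rpow_nonneg (abs_nonneg (y j)) q
            gcongr
            rcases max_cases |x j| |y j| with ⟨e, -⟩ | ⟨e, -⟩ <;> rw [e] <;> linarith
        _ = 2 ^ q * (X + Y) := by rw [← Finset.mul_sum, Finset.sum_add_distrib]
        _ ≤ _ := by
            have := le_max_left X Y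
            have := le_max_right X Y
            gcongr
            linarith
    have h4 := Real.rpow_le_rpow (sum_abs_rpow_nonneg J q fun j => x j - y j) h3
      (one_div_pos.2 hq).le
    rw [Real.mul_rpow (by positivity) (by positivity), Real.mul_rpow (by positivity) hM,
      ← Real.rpow_mul (by norm_num), mul_one_div_cancel hq.ne', Real.rpow_one] at h4
    have h5 : max X Y ^ (1 / q) ≤ max (X ^ (1 / q)) (Y ^ (1 / q)) := by
      rcases max_cases X Y with ⟨e, -⟩ | ⟨e, -⟩ <;> rw [e]
      exacts [le_max_left _ _, le_max_right _ _]
    have h6 : (2 : ℝ) ^ (1 / q) ≤ 2 ^ (1 / q₀) :=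
      Real.rpow_le_rpow_of_exponent_le (by norm_num) (one_div_le_one_div_of_le hq₀ hqq)
    refine h4.trans ?_
    rw [mul_assoc]
    have : 0 ≤ max X Y ^ (1 / q) := by positivity
    gcongr

end PowerSums

/-! ### Block norms as a gauge family -/

section BlockGauge

variable {k m : ℕ} {blk : Fin k → Fin m} {q : Fin m → ℝ}

theorem groupNorm_nonneg (y : Fin k → ℝ) (i : Fin m) : 0 ≤ groupNorm blk q y i :=
  Real.rpow_nonneg (sum_abs_rpow_nonneg _ _ _) _

theorem groupNorm_mul (hq : ∀ i, 0 < q i) (c : Fin m → ℝ) (y : Fin k → ℝ) (i : Fin m) :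
    groupNorm blk q (fun j => c (blk j) * y j) i = |c i| * groupNorm blk q y i := by
  have h1 : ∑ j ∈ group blk i, |c (blk j) * y j| ^ q i =
      |c i| ^ q i * ∑ j ∈ group blk i, |y j| ^ q i := by
    rw [Finset.mul_sum]
    refine Finset.sum_congr rfl fun j hj => ?_
    rw [group, Finset.mem_filter] at hj
    rw [hj.2, abs_mul, Real.mul_rpow (abs_nonneg _) (abs_nonneg _)]
  rw [groupNorm, h1, Real.mul_rpow (by positivity) (sum_abs_rpow_nonneg _ _ _),
    ← Real.rpow_mul (abs_nonneg _), mul_one_div_cancel (hq i).ne', Real.rpow_one, groupNorm]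

theorem groupNorm_mono (hq : ∀ i, 0 < q i) {x y : Fin k → ℝ} (h : ∀ j, |x j| ≤ |y j|)
    (i : Fin m) : groupNorm blk q x i ≤ groupNorm blk q y i := by
  unfold groupNorm
  have := sum_abs_rpow_nonneg (group blk i) (q i) x
  refine Real.rpow_le_rpow this (Finset.sum_le_sum fun j _ => ?_) (one_div_pos.2 (hq i)).le
  exact Real.rpow_le_rpow (abs_nonneg _) (h j) (hq i).le

theorem le_innerFactor (i : Fin m) :
    max 1 (min (q i) (Real.logb 2 ((group blk i).card : ℝ))) ≤ innerFactor blk q :=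
  max_le_max le_rfl (le_ciSup
    (f := fun i => min (q i) (Real.logb 2 ((group blk i).card : ℝ))) (Set.finite_range _).bddAbove i)

variable {V : Type*} [NormedAddCommGroup V] [InnerProductSpace ℝ V]

/-- The weighted group quasi-norms of the vector of values of the functionals `⟪u j, ·⟫`. -/
noncomputable def blockGauge (blk : Fin k → Fin m) (q : Fin m → ℝ) (lam : Fin m → ℝ)
    (u : Fin k → V) (i : Fin m) (y : V) : ℝ :=
  lam i ^ (-(1 / 2) : ℝ) * groupNorm blk q (fun j => inner ℝ (u j) y) i

variable {lam : Fin m → ℝ} {u : Fin k → V} {F q₀ : ℝ}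

/-- The bound by √F ‖y‖ is Cauchy–Schwarz in each coordinate, |⟪u_j, y⟫| ≤ ‖u_j‖ ‖y‖, followed by
the hypothesis on the group norms of the ‖u_j‖. -/
theorem isGaugeFamily_blockGauge (hq : ∀ i, 0 < q i) (hq₀ : 0 < q₀)
    (hqq : ∀ i, 2 ≤ (group blk i).card → q₀ ≤ q i) (hlam : IsPosProb lam) (hF : 0 < F)
    (hlev : ∀ i, groupNorm blk q (fun j => ‖u j‖) i ≤ √(lam i * F))
    (hsq : ∀ y, ‖y‖ ^ 2 ≤ ∑ i, groupNorm blk q (fun j => inner ℝ (u j) y) i ^ (2 : ℝ)) :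
    IsGaugeFamily lam (blockGauge blk q lam u) F (2 * 2 ^ (1 / q₀)) where
  lam_pos := hlam.pos
  lam_sum := hlam.sum_eq_one
  F_pos := hF
  one_le := by
    have : (1 : ℝ) ≤ 2 ^ (1 / q₀) := Real.one_le_rpow (by norm_num) (by positivity)
    linarith
  nonneg i y := mul_nonneg (Real.rpow_nonneg (hlam.pos i).le _) (groupNorm_nonneg _ _)
  smul i c y := by
    simp only [blockGauge, real_inner_smul_right]
    rw [groupNorm_mul hq (fun _ => c)]
    ring
  sub_le i x y := by
    have hl := Real.rpow_nonneg (hlam.pos i).le (-(1 / 2))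
    simp only [blockGauge, inner_sub_right]
    rw [← mul_max_of_nonneg _ _ hl, mul_left_comm]
    exact mul_le_mul_of_nonneg_left (sum_abs_sub_rpow_le _ (hq i) hq₀ (hqq i) _ _) hl
  le_norm i y := by
    have hl := hlam.pos i
    have h1 : groupNorm blk q (fun j => inner ℝ (u j) y) i ≤ ‖y‖ * √(lam i * F) := by
      calc _ ≤ groupNorm blk q (fun j => ‖y‖ * ‖u j‖) i := by
            refine groupNorm_mono hq (fun j => ?_) i
            rw [abs_mul, abs_norm, abs_norm, mul_comm]
            exact abs_real_inner_le_norm _ _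
        _ = ‖y‖ * groupNorm blk q (fun j => ‖u j‖) i := by
            rw [groupNorm_mul hq (fun _ => ‖y‖), abs_norm]
        _ ≤ _ := mul_le_mul_of_nonneg_left (hlev i) (norm_nonneg y)
    calc blockGauge blk q lam u i y ≤ lam i ^ (-(1 / 2) : ℝ) * (‖y‖ * √(lam i * F)) :=
          mul_le_mul_of_nonneg_left h1 (Real.rpow_nonneg hl.le _)
      _ = √F * ‖y‖ := by
          rw [Real.sqrt_mul hl.le, Real.rpow_neg hl.le, ← Real.sqrt_eq_rpow]
          have : √(lam i) ≠ 0 := (Real.sqrt_pos.2 hl).ne'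
          field_simp
  norm_sq_le y := by
    refine (hsq y).trans_eq (Finset.sum_congr rfl fun i _ => ?_)
    have hl := hlam.pos i
    rw [blockGauge, Real.mul_rpow (Real.rpow_nonneg hl.le _) (groupNorm_nonneg _ _),
      ← Real.rpow_mul hl.le, ← mul_assoc]
    have e : (-(1 / 2) * 2 : ℝ) = -1 := by norm_num
    rw [e, Real.rpow_neg_one, mul_inv_cancel₀ hl.ne', one_mul]
  cont i := by
    unfold blockGauge groupNorm
    refine continuous_const.mul (Continuous.rpow_const ?_ fun _ => Or.inr (one_div_pos.2 (hq i)).le)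
    refine continuous_finsetSum _ fun j _ => ?_
    exact Continuous.rpow_const (by fun_prop) fun _ => Or.inr (hq i).le

variable [FiniteDimensional ℝ V] [MeasurableSpace V] [BorelSpace V]

/-- Each inner exponent is first lowered to some r_i ≤ s, at the cost of a factor 2, so that the
Jensen moment bound applies. The bound then depends on s alone, however large the p_i are. -/
theorem lintegral_gaugeSum_blockGauge_le (hblk : Function.Surjective blk) (hq : ∀ i, 0 < q i)
    (hlam : IsPosProb lam) (hF : 0 < F)
    (hlev : ∀ i, groupNorm blk q (fun j => ‖u j‖) i ≤ √(lam i * F)) {s : ℝ}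
    (hs : innerFactor blk q ≤ s) :
    ∫⁻ v, ENNReal.ofReal (gaugeSum lam (blockGauge blk q lam u) s v) ∂(gaussianVolume V) ≤
      ENNReal.ofReal ((4 * √(F * s)) ^ s) * gaussianVolume V Set.univ := by
  have hs1 : 1 ≤ s := (le_max_left _ _).trans hs
  have hs0 : 0 < s := by linarith
  have hne : ∀ i, (group blk i).Nonempty := fun i => by
    obtain ⟨j, hj⟩ := hblk i
    exact ⟨j, by simp [group, hj]⟩
  choose r hr0 hr1 hr using fun i => exists_equivalent_exponent (group blk i) (hne i) (hq i)
  have hrs : ∀ i, r i ≤ s := fun i => (hr1 i).trans ((le_innerFactor i).trans hs)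
  have hpt : ∀ v, gaugeSum lam (blockGauge blk q lam u) s v ≤
      ∑ i, lam i ^ (1 - s / 2) * (∑ j ∈ group blk i, |inner ℝ (u j) v| ^ r i) ^ (s / r i) := by
    intro v
    refine Finset.sum_le_sum fun i _ => ?_
    have hl := hlam.pos i
    have h1 := Real.rpow_le_rpow (groupNorm_nonneg _ _) (hr i fun j => inner ℝ (u j) v).1 hs0.le
    rw [← Real.rpow_mul (sum_abs_rpow_nonneg _ _ _), one_div_mul_eq_div] at h1
    rw [blockGauge, Real.mul_rpow (Real.rpow_nonneg hl.le _) (groupNorm_nonneg _ _),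
      ← Real.rpow_mul hl.le, ← mul_assoc]
    nth_rewrite 1 [← Real.rpow_one (lam i)]
    rw [← Real.rpow_add hl]
    have e : (1 : ℝ) + -(1 / 2) * s = 1 - s / 2 := by ring
    rw [e]
    exact mul_le_mul_of_nonneg_left h1 (Real.rpow_nonneg hl.le _)
  -- The powers of λ_i recombine to λ_i, so summing over the groups costs nothing. The constant is 2
  -- · 2^s ≤ 4^s.
  have hterm : ∀ i, lam i ^ (1 - s / 2) * ((∑ j ∈ group blk i, ‖u j‖ ^ r i) ^ (s / r i) *
      (2 * s ^ (s / 2))) ≤ lam i * (4 * √(F * s)) ^ s := by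
    intro i
    have hl := hlam.pos i
    have h1 := (hr i fun j => ‖u j‖).2
    simp only [abs_norm] at h1
    have h2 : (∑ j ∈ group blk i, ‖u j‖ ^ r i) ^ (1 / r i) ≤ 2 * √(lam i * F) := by
      refine h1.trans (mul_le_mul_of_nonneg_left ?_ (by norm_num))
      have := hlev i
      simpa only [groupNorm, abs_norm] using this
    have h0 : 0 ≤ ∑ j ∈ group blk i, ‖u j‖ ^ r i := Finset.sum_nonneg fun j _ => by positivity
    have h3 := Real.rpow_le_rpow (by positivity) h2 hs0.le
    rw [← Real.rpow_mul h0, one_div_mul_eq_div] at h3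
    have e1 : lam i ^ (1 - s / 2) * lam i ^ (s / 2) = lam i := by
      rw [← Real.rpow_add hl]; simp
    have e2 : (2 * √(lam i * F)) ^ s = 2 ^ s * (lam i ^ (s / 2) * F ^ (s / 2)) := by
      rw [Real.mul_rpow (by norm_num) (Real.sqrt_nonneg _), Real.sqrt_eq_rpow,
        ← Real.rpow_mul (by positivity), one_div_mul_eq_div, Real.mul_rpow hl.le hF.le]
    have e3 : (4 * √(F * s)) ^ s = 2 ^ s * 2 ^ s * (F ^ (s / 2) * s ^ (s / 2)) := by
      have e4 : (4 : ℝ) ^ s = 2 ^ s * 2 ^ s := by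
        rw [← Real.mul_rpow (by norm_num) (by norm_num)]; norm_num
      rw [Real.mul_rpow (by norm_num) (Real.sqrt_nonneg _), Real.sqrt_eq_rpow,
        ← Real.rpow_mul (by positivity), one_div_mul_eq_div, Real.mul_rpow hF.le hs0.le, e4]
    have h4 : (2 : ℝ) ≤ 2 ^ s := by
      simpa using Real.rpow_le_rpow_of_exponent_le (by norm_num : (1 : ℝ) ≤ 2) hs1
    calc _ ≤ lam i ^ (1 - s / 2) * ((2 * √(lam i * F)) ^ s * (2 ^ s * s ^ (s / 2))) := by gcongr
      _ = lam i ^ (1 - s / 2) * lam i ^ (s / 2) * (4 * √(F * s)) ^ s := by rw [e2, e3]; ring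
      _ = _ := by rw [e1]
  calc _ ≤ ∫⁻ v, ∑ i, ENNReal.ofReal (lam i ^ (1 - s / 2)) *
        ENNReal.ofReal ((∑ j ∈ group blk i, |inner ℝ (u j) v| ^ r i) ^ (s / r i))
          ∂(gaussianVolume V) := by
        refine lintegral_mono fun v => (ENNReal.ofReal_le_ofReal (hpt v)).trans_eq ?_
        rw [ENNReal.ofReal_sum_of_nonneg fun i _ => mul_nonneg (Real.rpow_nonneg (hlam.pos i).le _)
          (Real.rpow_nonneg (sum_abs_rpow_nonneg _ _ _) _)]
        exact Finset.sum_congr rfl fun i _ =>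
          ENNReal.ofReal_mul (Real.rpow_nonneg (hlam.pos i).le _)
    _ ≤ ∑ i, ENNReal.ofReal (lam i * (4 * √(F * s)) ^ s) * gaussianVolume V Set.univ := by
        rw [lintegral_finsetSum _ fun i _ => by fun_prop]
        refine Finset.sum_le_sum fun i _ => ?_
        rw [lintegral_const_mul _ (by fun_prop)]
        refine (mul_le_mul_right
          (lintegral_sum_abs_inner_rpow_le (group blk i) u (hr0 i) (hrs i)) _).trans ?_
        rw [← mul_assoc, ← ENNReal.ofReal_mul (Real.rpow_nonneg (hlam.pos i).le _)]
        exact mul_le_mul_left (ENNReal.ofReal_le_ofReal (hterm i)) _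
    _ = _ := by
        rw [← Finset.sum_mul, ← ENNReal.ofReal_sum_of_nonneg fun i _ =>
          mul_nonneg (hlam.pos i).le (by positivity), ← Finset.sum_mul, hlam.sum_eq_one, one_mul]

theorem exists_cover_blockGauge (hblk : Function.Surjective blk) (hq : ∀ i, 0 < q i)
    (hq₀ : 0 < q₀) (hqq : ∀ i, 2 ≤ (group blk i).card → q₀ ≤ q i)
    (hlam : IsPosProb lam) (hF : 0 < F)
    (hlev : ∀ i, groupNorm blk q (fun j => ‖u j‖) i ≤ √(lam i * F))
    (hsq : ∀ y, ‖y‖ ^ 2 ≤ ∑ i, groupNorm blk q (fun j => inner ℝ (u j) y) i ^ (2 : ℝ))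
    {p : ℝ} (hp0 : 0 < p) (hp : p < 2) {η : ℝ} (hη : 0 < η) :
    ∃ T : Finset V, (T.card : ℝ) ≤ Real.exp (stepConst p (2 * 2 ^ (1 / q₀)) /
        (1 - 2 ^ (-(2 * p / (2 - p)))) *
        (F * (3 * innerFactor blk q * Real.logb 2 (max 2 F))) * η ^ (-(2 * p / (2 - p)))) ∧
      ∀ x, gaugeSum lam (blockGauge blk q lam u) p x ≤ 1 → ∃ c ∈ T, ‖x - c‖ ≤ η := by
  have hI : 1 ≤ innerFactor blk q := le_max_left _ _
  have hF2 : 0 < max 2 F := by positivity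
  have hlog : 1 ≤ Real.logb 2 (max 2 F) := by
    rw [Real.le_logb_iff_rpow_le (by norm_num) hF2, Real.rpow_one]; exact le_max_left _ _
  have hIl : innerFactor blk q ≤ innerFactor blk q * Real.logb 2 (max 2 F) :=
    le_mul_of_one_le_right (by linarith) hlog
  have hlI : Real.logb 2 (max 2 F) ≤ innerFactor blk q * Real.logb 2 (max 2 F) :=
    le_mul_of_one_le_left (by linarith) hI
  -- With s = 3 · `innerFactor` · log₂ max(2, F), both factors being at least 1, all three demands
  -- hold: s > 2, F ≤ 2^s and s ≥ `innerFactor`.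
  refine (isGaugeFamily_blockGauge hq hq₀ hqq hlam hF hlev hsq).exists_cover hp0 hp
    (by rw [mul_assoc]; linarith) ?_
    (lintegral_gaugeSum_blockGauge_le hblk hq hlam hF hlev (by rw [mul_assoc]; linarith)) hη
  calc F ≤ max 2 F := le_max_right _ _
    _ = 2 ^ Real.logb 2 (max 2 F) := by rw [Real.rpow_logb (by norm_num) (by norm_num) hF2]
    _ ≤ _ := Real.rpow_le_rpow_of_exponent_le (by norm_num) (by rw [mul_assoc]; linarith)

end BlockGauge

/-! ### Leverage scores and projections to the column space -/

section Leverage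

variable {k n : ℕ}

theorem sum_dotProduct_mul_dotProduct
    (b : OrthonormalBasis (Fin n) ℝ (EuclideanSpace ℝ (Fin n))) (v x : Fin n → ℝ) :
    ∑ i, (v ⬝ᵥ ⇑(b i)) * (⇑(b i) ⬝ᵥ x) = v ⬝ᵥ x := by
  have h := b.sum_inner_mul_inner (WithLp.toLp 2 v) (WithLp.toLp 2 x)
  simpa [PiLp.inner_apply, dotProduct, mul_comm] using h

theorem l2Norm_sq (y : Fin k → ℝ) : l2Norm y ^ 2 = y ⬝ᵥ y := by
  rw [l2Norm, EuclideanSpace.real_norm_sq_eq]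
  simp [dotProduct, sq]

theorem leverageScore_eq_sum (M : Matrix (Fin k) (Fin n) ℝ) (j : Fin k) :
    leverageScore M j = ∑ i, ((gram_isHermitian M).eigenvalues i)⁻¹ *
      (M j ⬝ᵥ ⇑((gram_isHermitian M).eigenvectorBasis i)) ^ 2 := by
  rw [leverageScore, symmPinv, Matrix.sum_mulVec, dotProduct_sum]
  refine Finset.sum_congr rfl fun i _ => ?_
  rw [Matrix.smul_mulVec, dotProduct_smul, Matrix.vecMulVec_mulVec, smul_eq_mul]
  simp only [op_smul_eq_smul, dotProduct_smul, smul_eq_mul]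
  rw [dotProduct_comm (M j), sq]

theorem l2Norm_mulVec_sq_eq_gram (M : Matrix (Fin k) (Fin n) ℝ) (x : Fin n → ℝ) :
    l2Norm (M *ᵥ x) ^ 2 = x ⬝ᵥ ((Mᵀ * M) *ᵥ x) := by
  rw [l2Norm_sq, ← Matrix.mulVec_mulVec, Matrix.dotProduct_mulVec x, Matrix.vecMul_transpose]

theorem l2Norm_mulVec_sq (M : Matrix (Fin k) (Fin n) ℝ) (x : Fin n → ℝ) :
    l2Norm (M *ᵥ x) ^ 2 = ∑ i, (gram_isHermitian M).eigenvalues i *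
      (⇑((gram_isHermitian M).eigenvectorBasis i) ⬝ᵥ x) ^ 2 := by
  rw [l2Norm_mulVec_sq_eq_gram, ← sum_dotProduct_mul_dotProduct (gram_isHermitian M).eigenvectorBasis]
  refine Finset.sum_congr rfl fun i _ => ?_
  have hsymm : (Mᵀ * M)ᵀ = Mᵀ * M := by rw [Matrix.transpose_mul, Matrix.transpose_transpose]
  rw [Matrix.dotProduct_mulVec, ← Matrix.mulVec_transpose, hsymm,
    (gram_isHermitian M).mulVec_eigenvectorBasis, smul_dotProduct, smul_eq_mul,
    dotProduct_comm x]
  ring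

theorem gram_eigenvalues_eq (M : Matrix (Fin k) (Fin n) ℝ) (i : Fin n) :
    (gram_isHermitian M).eigenvalues i =
      l2Norm (M *ᵥ ⇑((gram_isHermitian M).eigenvectorBasis i)) ^ 2 := by
  set b := (gram_isHermitian M).eigenvectorBasis with hb
  have h1 : ⇑(b i) ⬝ᵥ ⇑(b i) = 1 := by
    have := l2Norm_sq ⇑(b i)
    rw [← this]
    have h2 := b.norm_eq_one i
    simp [l2Norm, h2]
  rw [l2Norm_mulVec_sq_eq_gram,
    (gram_isHermitian M).mulVec_eigenvectorBasis, ← hb, dotProduct_smul, h1, smul_eq_mul, mul_one]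

/-- Cauchy–Schwarz in an eigenbasis of the Gram matrix, with weights μ⁻¹ and μ. -/
theorem sq_mulVec_le_leverageScore (M : Matrix (Fin k) (Fin n) ℝ) (x : Fin n → ℝ) (j : Fin k) :
    (M *ᵥ x) j ^ 2 ≤ leverageScore M j * l2Norm (M *ᵥ x) ^ 2 := by
  have hpos : ∀ i, 0 ≤ (gram_isHermitian M).eigenvalues i := fun i => by
    rw [gram_eigenvalues_eq]; positivity
  rw [leverageScore_eq_sum, l2Norm_mulVec_sq, Matrix.mulVec,
    ← sum_dotProduct_mul_dotProduct (gram_isHermitian M).eigenvectorBasis]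
  refine Finset.sum_sq_le_sum_mul_sum_of_sq_le_mul _ (fun i _ => ?_) (fun i _ => ?_)
    (fun i _ => ?_)
  · have := hpos i; positivity
  · have := hpos i; positivity
  -- An eigenvector with eigenvalue 0 is killed by M, hence orthogonal to the row, so the convention
  -- 0⁻¹ = 0 loses nothing.
  · by_cases h0 : (gram_isHermitian M).eigenvalues i = 0
    · have h1 := gram_eigenvalues_eq M i
      rw [h0, l2Norm_sq] at h1
      have h2 := congrFun (dotProduct_self_eq_zero.1 h1.symm) j
      rw [Matrix.mulVec, Pi.zero_apply] at h2
      rw [h2, h0]; simp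
    · apply le_of_eq; field_simp

/-- The column space of a matrix. -/
noncomputable def columnSpace (M : Matrix (Fin k) (Fin n) ℝ) :
    Submodule ℝ (EuclideanSpace ℝ (Fin k)) :=
  LinearMap.range (Matrix.toEuclideanLin M)

/-- The leverage score bounds the squared norm of the projection of a standard basis vector to the
column space. -/
theorem norm_orthogonalProjection_single_sq_le (M : Matrix (Fin k) (Fin n) ℝ) (j : Fin k) :
    ‖(columnSpace M).orthogonalProjectionOnto
      (EuclideanSpace.single j (1 : ℝ))‖ ^ 2 ≤ leverageScore M j := by
  set K := columnSpace M
  set P := K.orthogonalProjectionOnto (EuclideanSpace.single j (1 : ℝ)) with hP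
  obtain ⟨x, hx⟩ := P.2
  have hPx : (P : EuclideanSpace ℝ (Fin k)) = WithLp.toLp 2 (M *ᵥ x.ofLp) := by
    rw [← hx, Matrix.toLpLin_apply]
  -- Since P = Mx is the projection of e_j, ‖P‖² = ⟪e_j, P⟫. The preceding inequality then reads
  -- ‖P‖⁴ ≤ τ_j ‖P‖².
  have h1 : ‖P‖ ^ 2 = (M *ᵥ x.ofLp) j := by
    rw [← real_inner_self_eq_norm_sq]
    nth_rewrite 1 [hP]
    rw [Submodule.inner_orthogonalProjectionOnto_eq_of_mem_right, EuclideanSpace.inner_single_left,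
      hPx]
    simp
  have h2 : ‖P‖ = l2Norm (M *ᵥ x.ofLp) := by rw [l2Norm, ← hPx, Submodule.norm_coe]
  have h3 := sq_mulVec_le_leverageScore M x.ofLp j
  rw [← h1, ← h2] at h3
  rcases (sq_nonneg ‖P‖).eq_or_lt with h0 | hpos
  · rw [← h0, leverageScore_eq_sum]
    refine Finset.sum_nonneg fun i _ => mul_nonneg (inv_nonneg.2 ?_) (sq_nonneg _)
    rw [gram_eigenvalues_eq]; positivity
  · rw [sq (‖P‖ ^ 2)] at h3
    exact le_of_mul_le_mul_right h3 hpos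

end Leverage

/-! ### Transfer to the column space of the rounded matrix -/

section Rounded

variable {k n m : ℕ} {A : Matrix (Fin k) (Fin n) ℝ} {blk : Fin k → Fin m} {q : Fin m → ℝ}
  {p F : ℝ} {lam : Fin m → ℝ} {w : Fin k → ℝ}

theorem measureScaled_mulVec (s : ℝ) (x : Fin n → ℝ) (j : Fin k) :
    (measureScaled blk lam s A *ᵥ x) j = lam (blk j) ^ s * (A *ᵥ x) j := by
  rw [measureScaled, ← Matrix.mulVec_mulVec, Matrix.mulVec_diagonal]

theorem roundedMatrix_mulVec (x : Fin n → ℝ) (j : Fin k) :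
    (roundedMatrix blk p lam w A *ᵥ x) j =
      w j ^ (1 / 2 : ℝ) * (lam (blk j) ^ (1 / 2 - 1 / p) * (A *ᵥ x) j) := by
  rw [roundedMatrix, ← Matrix.mulVec_mulVec, Matrix.mulVec_diagonal, measureScaled_mulVec]

/-- The functionals `y ↦ w_j^{-1/2} y_j` on the column space of the rounded matrix. -/
noncomputable def coordVector (M : Matrix (Fin k) (Fin n) ℝ) (w : Fin k → ℝ) (j : Fin k) :
    columnSpace M :=
  (w j ^ (1 / 2 : ℝ))⁻¹ • (columnSpace M).orthogonalProjectionOnto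
    (EuclideanSpace.single j (1 : ℝ))

theorem inner_coordVector (M : Matrix (Fin k) (Fin n) ℝ) (w : Fin k → ℝ) (j : Fin k)
    (y : columnSpace M) :
    inner ℝ (coordVector M w j) y =
      (w j ^ (1 / 2 : ℝ))⁻¹ * (y : EuclideanSpace ℝ (Fin k)).ofLp j := by
  refine (real_inner_smul_left (F := columnSpace M) _ _ _).trans ?_
  rw [Submodule.inner_orthogonalProjectionOnto_eq_of_mem_right, EuclideanSpace.inner_single_left]
  simp

/-- The image of `x` in the column space of `M`. -/
noncomputable def toRange (M : Matrix (Fin k) (Fin n) ℝ) (x : Fin n → ℝ) :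
    columnSpace M :=
  ⟨WithLp.toLp 2 (M *ᵥ x), ⟨WithLp.toLp 2 x, by rw [Matrix.toLpLin_apply]⟩⟩

theorem toRange_surjective (M : Matrix (Fin k) (Fin n) ℝ) : Function.Surjective (toRange M) := by
  rintro ⟨_, x, rfl⟩
  exact ⟨x.ofLp, rfl⟩

theorem norm_toRange_sub (M : Matrix (Fin k) (Fin n) ℝ) (x y : Fin n → ℝ) :
    ‖toRange M x - toRange M y‖ = l2Norm (M *ᵥ (x - y)) := by
  rw [l2Norm, Matrix.mulVec_sub, WithLp.toLp_sub, ← Submodule.norm_coe, Submodule.coe_sub,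
    toRange, toRange]

theorem inner_coordVector_toRange (hw : ∀ j, 0 < w j) (x : Fin n → ℝ) (j : Fin k) :
    inner ℝ (coordVector (roundedMatrix blk p lam w A) w j)
      (toRange (roundedMatrix blk p lam w A) x) =
        lam (blk j) ^ (1 / 2 - 1 / p) * (A *ᵥ x) j := by
  rw [inner_coordVector, toRange]
  simp only [roundedMatrix_mulVec]
  rw [inv_mul_cancel_left₀ (Real.rpow_pos_of_pos (hw j) _).ne']

theorem groupNorm_coordVector_le (hq : ∀ i, 0 < q i)
    (h : IsBlockLewisOverestimate A blk q p lam w F) (i : Fin m) :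
    groupNorm blk q (fun j => ‖coordVector (roundedMatrix blk p lam w A) w j‖) i ≤
      √(lam i * F) := by
  have hl := h.prob.pos i
  have hw := h.rounding.pos
  set M := roundedMatrix blk p lam w A
  have h1 : ∀ j, ‖coordVector M w j‖ ^ 2 ≤ leverageScore M j / w j := fun j => by
    have h2 := norm_orthogonalProjection_single_sq_le M j
    have h3 : ((w j ^ (1 / 2 : ℝ))⁻¹) ^ 2 = (w j)⁻¹ := by
      rw [inv_pow, ← Real.sqrt_eq_rpow, Real.sq_sqrt (hw j).le]
    rw [coordVector, norm_smul, mul_pow, norm_inv, Real.norm_of_nonneg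
      (Real.rpow_nonneg (hw j).le _), h3, inv_mul_eq_div]
    have := hw j
    gcongr
  have h4 : ∑ j ∈ group blk i, |‖coordVector M w j‖| ^ q i ≤
      ∑ j ∈ group blk i, (leverageScore M j / w j) ^ (q i / 2) := by
    refine Finset.sum_le_sum fun j _ => ?_
    have := Real.rpow_le_rpow (sq_nonneg _) (h1 j) (half_pos (hq i)).le
    rwa [← Real.rpow_natCast, ← Real.rpow_mul (norm_nonneg _), Nat.cast_ofNat,
      mul_div_cancel₀ _ two_ne_zero, ← abs_norm] at this
  have h5 := Real.rpow_le_rpow (sum_abs_rpow_nonneg _ _ _) h4 (div_pos two_pos (hq i)).le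
  have h6 := h.le i
  rw [one_div_mul_eq_div, div_le_iff₀ hl, mul_comm F] at h6
  apply Real.le_sqrt_of_sq_le
  refine le_trans (le_of_eq ?_) (h5.trans h6)
  rw [groupNorm, ← Real.rpow_natCast, ← Real.rpow_mul (sum_abs_rpow_nonneg _ _ _)]
  congr 1
  push_cast; ring

theorem norm_sq_le_sum_groupNorm (h : IsBlockLewisOverestimate A blk q p lam w F)
    (y : columnSpace (roundedMatrix blk p lam w A)) :
    ‖y‖ ^ 2 ≤ ∑ i, groupNorm blk q
      (fun j => inner ℝ (coordVector (roundedMatrix blk p lam w A) w j) y) i ^ (2 : ℝ) := by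
  obtain ⟨x, rfl⟩ := toRange_surjective _ y
  have h1 : ‖toRange (roundedMatrix blk p lam w A) x‖ ≤
      blockNorm blk q 2 (measureScaled blk lam (1 / 2 - 1 / p) A *ᵥ x) :=
    h.rounding.le x
  have h2 : (fun j => inner ℝ (coordVector (roundedMatrix blk p lam w A) w j)
      (toRange (roundedMatrix blk p lam w A) x)) =
        measureScaled blk lam (1 / 2 - 1 / p) A *ᵥ x := by
    funext j
    rw [inner_coordVector_toRange h.rounding.pos, measureScaled_mulVec]
  rw [h2]
  have h0 : 0 ≤ ∑ i, groupNorm blk q (measureScaled blk lam (1 / 2 - 1 / p) A *ᵥ x) i ^ (2 : ℝ) :=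
    Finset.sum_nonneg fun i _ => Real.rpow_nonneg (groupNorm_nonneg _ i) _
  have h3 := pow_le_pow_left₀ (norm_nonneg _) h1 2
  rwa [blockNorm, ← Real.sqrt_eq_rpow, Real.sq_sqrt h0] at h3

theorem gaugeSum_toRange_le_one (hp : 0 < p) (hq : ∀ i, 0 < q i)
    (h : IsBlockLewisOverestimate A blk q p lam w F) {x : Fin n → ℝ}
    (hx : x ∈ blockBall A blk q p) :
    gaugeSum lam (blockGauge blk q lam (coordVector (roundedMatrix blk p lam w A) w)) p
      (toRange (roundedMatrix blk p lam w A) x) ≤ 1 := by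
  have h0 : 0 ≤ ∑ i, groupNorm blk q (A *ᵥ x) i ^ p :=
    Finset.sum_nonneg fun i _ => Real.rpow_nonneg (groupNorm_nonneg _ i) _
  have hx' : (∑ i, groupNorm blk q (A *ᵥ x) i ^ p) ^ (1 / p) ≤ 1 := hx
  replace hx' := (Real.rpow_le_rpow_iff h0 zero_le_one (one_div_pos.2 hp)).1
    (hx'.trans_eq (Real.one_rpow _).symm)
  refine le_trans (le_of_eq ?_) hx'
  refine Finset.sum_congr rfl fun i _ => ?_
  have hl := h.prob.pos i
  have hl0 := Real.rpow_nonneg hl.le (1 / 2 - 1 / p)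
  simp only [blockGauge, inner_coordVector_toRange h.rounding.pos]
  rw [groupNorm_mul hq (fun i => lam i ^ (1 / 2 - 1 / p)), abs_of_nonneg hl0, ← mul_assoc,
    ← Real.rpow_add hl, Real.mul_rpow (Real.rpow_nonneg hl.le _) (groupNorm_nonneg _ i),
    ← Real.rpow_mul hl.le]
  have e : (-(1 / 2) + (1 / 2 - 1 / p)) * p = -1 := by field_simp; ring
  rw [e, Real.rpow_neg_one, mul_inv_cancel_left₀ hl.ne']

/-- Every centre in the column space is the image of some vector, and the preimage of the η-ball
about it is a translate of the scaled `roundedBall`. The matrix need not be injective. -/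
theorem coveringNumber_le_of_cover {X : Set (Fin n → ℝ)} {η : ℝ} (hη : 0 < η)
    (T : Finset (columnSpace (roundedMatrix blk p lam w A)))
    (hT : ∀ x ∈ X, ∃ c ∈ T, ‖toRange (roundedMatrix blk p lam w A) x - c‖ ≤ η) :
    coveringNumber X (η • roundedBall A blk p lam w) ≤ T.card := by
  choose g hg using toRange_surjective (roundedMatrix blk p lam w A)
  refine iInf₂_le T.card ⟨fun i => g (T.equivFin.symm i), fun x hx => ?_⟩
  obtain ⟨c, hc, hxc⟩ := hT x hx
  refine Set.mem_iUnion.2 ⟨T.equivFin ⟨c, hc⟩, ?_⟩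
  rw [Set.mem_vadd_set_iff_neg_vadd_mem, Set.mem_smul_set_iff_inv_smul_mem₀ hη.ne']
  simp only [Equiv.symm_apply_apply, vadd_eq_add]
  rw [← hg c, norm_toRange_sub] at hxc
  change l2Norm (roundedMatrix blk p lam w A *ᵥ (η⁻¹ • (-g c + x))) ≤ 1
  rw [Matrix.mulVec_smul, l2Norm, WithLp.toLp_smul, norm_smul, norm_inv,
    Real.norm_of_nonneg hη.le, inv_mul_le_one₀ hη, neg_add_eq_sub]
  exact hxc

end Rounded

end BlockLewis

/-! ### The covering bound -/

open BlockLewis in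
theorem mainTheorem6 (p q₀ : ℝ) (hp0 : 0 < p) (hp2 : p < 2) (hq₀ : 0 < q₀) :
    ∃ C : ℝ, 0 < C ∧
      ∀ (k n m : ℕ) (A : Matrix (Fin k) (Fin n) ℝ) (blk : Fin k → Fin m) (q : Fin m → ℝ)
        (lam : Fin m → ℝ) (w : Fin k → ℝ) (F η : ℝ),
        Function.Surjective blk →
        (∀ i, 0 < q i) →
        (∀ i, 2 ≤ (BlockLewis.group blk i).card → q₀ ≤ q i) →
        BlockLewis.IsBlockLewisOverestimate A blk q p lam w F →
        0 < η →
        BlockLewis.coveringNumber (BlockLewis.blockBall A blk q p)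
            (η • BlockLewis.roundedBall A blk p lam w) ≠ ⊤ ∧
        Real.logb 2 ((BlockLewis.coveringNumber (BlockLewis.blockBall A blk q p)
            (η • BlockLewis.roundedBall A blk p lam w)).toNat : ℝ) ≤
          η ^ (-(2 * p / (2 - p))) * C * BlockLewis.innerFactor blk q *
            (F * Real.logb 2 (max 2 F)) := by
  have h2p : 0 < 2 - p := by linarith
  have ha : 0 < 2 * p / (2 - p) := by positivity
  have h2a : (2 : ℝ) ^ (-(2 * p / (2 - p))) < 1 :=
    Real.rpow_lt_one_of_one_lt_of_neg (by norm_num) (by linarith)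
  have hD : 0 < stepConst p (2 * 2 ^ (1 / q₀)) / (1 - 2 ^ (-(2 * p / (2 - p)))) := by
    refine div_pos ?_ (by linarith)
    unfold stepConst
    positivity
  set D := stepConst p (2 * 2 ^ (1 / q₀)) / (1 - 2 ^ (-(2 * p / (2 - p)))) with hDdef
  have hlog2 : 0 < Real.log 2 := Real.log_pos one_lt_two
  -- The 3 comes from the choice of s, and log 2 from passing to base 2.
  refine ⟨D * 3 / Real.log 2, by positivity, ?_⟩
  intro k n m A blk q lam w F η hblk hq hqq h hη
  obtain ⟨T, hcard, hT⟩ := exists_cover_blockGauge hblk hq hq₀ hqq h.prob h.F_pos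
    (groupNorm_coordVector_le hq h) (norm_sq_le_sum_groupNorm h) hp0 hp2 hη
  have hle := coveringNumber_le_of_cover hη T
    fun x hx => hT _ (gaugeSum_toRange_le_one hp0 hq h hx)
  refine ⟨ne_top_of_le_ne_top (ENat.natCast_ne_top _) hle, ?_⟩
  set N := (coveringNumber (blockBall A blk q p) (η • roundedBall A blk p lam w)).toNat
  have hN : N ≤ T.card := ENat.toNat_le_of_le_natCast hle
  have hF := h.F_pos
  have hI : 1 ≤ innerFactor blk q := le_max_left _ _
  have hlogF : 0 ≤ Real.logb 2 (max 2 F) :=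
    Real.logb_nonneg one_lt_two (le_max_of_le_left one_le_two)
  have hη' := Real.rpow_pos_of_pos hη (-(2 * p / (2 - p)))
  rcases Nat.eq_zero_or_pos N with h0 | hpos
  · rw [h0, Nat.cast_zero, Real.logb_zero]
    positivity
  · have h1 : (N : ℝ) ≤ T.card := by exact_mod_cast hN
    have h2 := Real.log_le_log (by exact_mod_cast hpos) (h1.trans hcard)
    rw [Real.log_exp, ← hDdef] at h2
    rw [Real.logb, div_le_iff₀ hlog2]
    refine h2.trans_eq ?_
    field_simp
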